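/- Setting. Let $\mathbb C^\times=\mathbb C/(z\sim z+1)$, with coordinate $z$ and circle $C=\{z\in[0,1]\}$. Let $H$ be a finite-dimensional (purely even) complex vector space with basis $\{\mathcal O_\alpha\}$ and a nondegenerate symmetric inner product $g_{\alpha\beta}$ with inverse matrix $g^{\alpha\beta}$. A field is $\mu=\sum_{k\ge 0,\alpha}(\lambda^\alpha_k\otimes\mathcal O_\alpha t^k+\rho^\alpha_k\,\partial_z\otimes\mathcal O_\alpha t^k)$ with $\lambda^\alpha_k,\rho^\alpha_k\in\Omega^{0,\bullet}(\mathbb C^\times)$ smooth; the maps $\partial_z^m\lambda^\alpha_k$ are even and the maps $\partial_z^m\rho^\alpha_k$ are odd. Let $\mathcal L\in\mathbb C[\![\partial_z^m\lambda^\alpha_k,\partial_z^m\rho^\alpha_k]\!]$ be a power series in these (super)commuting symbols, i.e. a formal sum of homogeneous polynomials, one in each degree. Put $\mathscr J_{\mathcal L}=dz\,\mathcal L=\mathscr J^{(1)}_{\mathcal L}+\mathscr J^{(2)}_{\mathcal L}$, split into its $1$-form and $2$-form parts; $\oint_C\mathscr J^{(1)}_{\mathcal L}$ is a formal function on fields and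 $\int_{\mathbb C^\times}\mathscr J^{(2)}_{\mathcal L}$ is a local functional on compactly supported fields. The BV kernel is $K_0=\sum_{\alpha,\beta}g^{\alpha\beta}(\mathcal O_\alpha\otimes\mathcal O_\beta)\,\partial_z\delta(z-w)(d\bar z-d\bar w)$. For a local functional $S$, $\{S,-\}_{\mathrm{BV}}$ is the derivation of observables given by the infinitesimal transformation $\delta_S\lambda_0^\beta=-\sum_\alpha g^{\alpha\beta}\partial_z\frac{\delta S}{\delta\lambda_0^\alpha}$ (the contraction of $K_0$ with the variation $\delta S=\int dz\sum_\alpha\delta\lambda^\alpha_0\,\frac{\delta S}{\delta\lambda^\alpha_0}$ of $S$ in the directions $\lambda_0$), $\delta_S\lambda^\beta_k=0$ for $k\geq 1$ and $\delta_S\rho^\beta_k=0$ for $k\ge 0$. Proposition. Let $\mathcal L_1,\mathcal L_2\in\mathbb C[\![\partial_z^m\lambda^\alpha_k,\partial_z^m\rho^\alpha_k]\!]$ and put $$[\mathcal L_1,\mathcal L_2]:=\sum_{\alpha,\beta,k,m}\left(\left(-\tfrac{\partial}{\partial z}\right)^k\frac{\partial\mathcal L_1}{\partial(\partial_z^k\lambda_0^\alpha)}\right)g^{\alpha\beta}\,\frac{\partial}{\partial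 z}\left(\left(-\tfrac{\partial}{\partial z}\right)^m\frac{\partial\mathcal L_2}{\partial(\partial_z^m\lambda_0^\beta)}\right).$$ Then the brackets below exist, are uniquely determined, and satisfy the following. (1) Modulo total $\partial_z$-derivatives, $\left\{\int_{\mathbb C^\times}\mathscr J^{(2)}_{\mathcal L_1},\oint_C\mathscr J^{(1)}_{\mathcal L_2}\right\}_{\mathrm{BV}}=\oint_C\mathscr J^{(1)}_{[\mathcal L_1,\mathcal L_2]}$. That is, there is a power series $\mathcal M$ such that on all fields $$\left\{\int_{\mathbb C^\times}\mathscr J^{(2)}_{\mathcal L_1},\oint_C\mathscr J^{(1)}_{\mathcal L_2}\right\}_{\mathrm{BV}}=\oint_C\mathscr J^{(1)}_{[\mathcal L_1,\mathcal L_2]}+\oint_C\mathscr J^{(1)}_{\partial_z\mathcal M},$$ and on all fields that are $\bar\partial$-closed in a neighbourhood of $C$ the identity $\left\{\int_{\mathbb C^\times}\mathscr J^{(2)}_{\mathcal L_1},\oint_C\mathscr J^{(1)}_{\mathcal L_2}\right\}_{\mathrm{BV}}=\oint_C\mathscr J^{(1)}_{[\mathcal L_1,\mathcal L_2]}$ holds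 exactly. (2) On all compactly supported fields, $\left\{\int_{\mathbb C^\times}\mathscr J^{(2)}_{\mathcal L_1},\int_{\mathbb C^\times}\mathscr J^{(2)}_{\mathcal L_2}\right\}_{\mathrm{BV}}=\int_{\mathbb C^\times}\mathscr J^{(2)}_{[\mathcal L_1,\mathcal L_2]}$. -/

import Mathlib

open scoped ContDiff

/-! ### Grassmann algebras

`Gr G` is the (completed) Grassmann algebra on a totally ordered set `G` of odd generators.
An element is the family of its coefficients: `a I` is the coefficient of the ordered product
of the generators in the finite set `I`. -/

/-- Elements of the Grassmann algebra on `G`, as families of coefficients. -/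
@[ext] structure Gr (G : Type) : Type where
  coeff : Finset G → ℂ

namespace Gr

/-- An element is its family of coefficients. -/
def equivFun (G : Type) : Gr G ≃ (Finset G → ℂ) := ⟨coeff, mk, fun _ => rfl, fun _ => rfl⟩

noncomputable instance (G : Type) : AddCommGroup (Gr G) := (equivFun G).addCommGroup

noncomputable instance (G : Type) : Module ℂ (Gr G) := (equivFun G).module ℂ

theorem add_apply {G : Type} (a b : Gr G) (I : Finset G) :
    (a + b).coeff I = a.coeff I + b.coeff I := rfl

theorem neg_apply {G : Type} (a : Gr G) (I : Finset G) : (-a).coeff I = -a.coeff I := rfl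

theorem zero_apply {G : Type} (I : Finset G) : (0 : Gr G).coeff I = 0 := rfl

theorem smul_apply {G : Type} (c : ℂ) (a : Gr G) (I : Finset G) :
    (c • a).coeff I = c * a.coeff I := rfl

variable {G : Type} [LinearOrder G]

/-- The sign produced by sorting the product of the monomials `J` and `K`. -/
noncomputable def sgn (J K : Finset G) : ℂ := ∏ j ∈ J, ∏ k ∈ K, if k < j then -1 else 1

noncomputable instance : Mul (Gr G) :=
  ⟨fun a b => ⟨fun I => ∑ J ∈ I.powerset, sgn J (I \ J) * (a.coeff J * b.coeff (I \ J))⟩⟩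

noncomputable instance : One (Gr G) := ⟨⟨fun I => if I = ∅ then 1 else 0⟩⟩

theorem mul_apply (a b : Gr G) (I : Finset G) :
    (a * b).coeff I = ∑ J ∈ I.powerset, sgn J (I \ J) * (a.coeff J * b.coeff (I \ J)) := rfl

theorem one_apply (I : Finset G) : (1 : Gr G).coeff I = if I = ∅ then 1 else 0 := rfl

theorem sgn_union_left {J K : Finset G} (M : Finset G) (h : Disjoint J K) :
    sgn (J ∪ K) M = sgn J M * sgn K M := Finset.prod_union h

theorem sgn_union_right (J : Finset G) {K M : Finset G} (h : Disjoint K M) :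
    sgn J (K ∪ M) = sgn J K * sgn J M := by
  simp only [sgn, Finset.prod_union h, Finset.prod_mul_distrib]

theorem sgn_empty_left (J : Finset G) : sgn ∅ J = 1 := by simp [sgn]

theorem sgn_empty_right (J : Finset G) : sgn J ∅ = 1 := by simp [sgn]

theorem sgn_swap {J K : Finset G} (h : Disjoint J K) :
    sgn K J = (-1) ^ (J.card * K.card) * sgn J K := by
  have h1 : sgn K J = ∏ j ∈ J, ∏ k ∈ K, if j < k then (-1 : ℂ) else 1 := Finset.prod_comm
  have h2 : ((-1 : ℂ)) ^ (J.card * K.card) = ∏ _j ∈ J, ∏ _k ∈ K, (-1 : ℂ) := by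
    simp [pow_mul, pow_right_comm]
  rw [h1, h2, sgn, ← Finset.prod_mul_distrib]
  refine Finset.prod_congr rfl fun j hj => ?_
  rw [← Finset.prod_mul_distrib]
  refine Finset.prod_congr rfl fun k hk => ?_
  have hne : j ≠ k := fun e => Finset.disjoint_left.mp h hj (e ▸ hk)
  rcases lt_or_gt_of_ne hne with hlt | hlt
  · simp [hlt, not_lt.mpr hlt.le]
  · simp [hlt, not_lt.mpr hlt.le]

theorem mul_assoc' (a b c : Gr G) : a * b * c = a * (b * c) := by
  ext I
  simp only [mul_apply, Finset.mul_sum, Finset.sum_mul]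
  rw [Finset.sum_sigma', Finset.sum_sigma']
  refine Finset.sum_bij' (fun x _ => ⟨x.2, x.1 \ x.2⟩) (fun x _ => ⟨x.1 ∪ x.2, x.1⟩)
    ?_ ?_ ?_ ?_ ?_
  · rintro ⟨J, K⟩ h
    simp only [Finset.mem_sigma, Finset.mem_powerset] at h ⊢
    exact ⟨h.2.trans h.1, Finset.sdiff_subset_sdiff h.1 le_rfl⟩
  · rintro ⟨K, M⟩ h
    simp only [Finset.mem_sigma, Finset.mem_powerset] at h ⊢
    exact ⟨Finset.union_subset h.1 (h.2.trans Finset.sdiff_subset), Finset.subset_union_left⟩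
  · rintro ⟨J, K⟩ h
    simp only [Finset.mem_sigma, Finset.mem_powerset] at h
    simp [Finset.union_sdiff_of_subset h.2]
  · rintro ⟨K, M⟩ h
    simp only [Finset.mem_sigma, Finset.mem_powerset] at h
    have : (K ∪ M) \ K = M := by
      rw [Finset.union_sdiff_left]
      exact Finset.sdiff_eq_self_of_disjoint (Finset.disjoint_of_subset_left h.2
        Finset.sdiff_disjoint)
    simp [this]
  · rintro ⟨J, K⟩ h
    simp only [Finset.mem_sigma, Finset.mem_powerset] at h
    obtain ⟨hJ, hK⟩ := h
    have e1 : (I \ K) \ (J \ K) = I \ J := by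
      ext x; simp only [Finset.mem_sdiff]; have := @hK x; tauto
    have e2 : I \ K = (J \ K) ∪ (I \ J) := by
      ext x; simp only [Finset.mem_sdiff, Finset.mem_union]
      have := @hK x; have := @hJ x; tauto
    have d1 : Disjoint (J \ K) (I \ J) :=
      Finset.disjoint_of_subset_left Finset.sdiff_subset Finset.disjoint_sdiff
    have e3 : sgn J (I \ J) = sgn K (I \ J) * sgn (J \ K) (I \ J) := by
      conv_lhs => rw [← Finset.union_sdiff_of_subset hK]
      rw [Finset.union_sdiff_of_subset hK]
      rw [← sgn_union_left _ Finset.disjoint_sdiff, Finset.union_sdiff_of_subset hK]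
    have e4 : sgn K (I \ K) = sgn K (J \ K) * sgn K (I \ J) := by
      rw [e2, sgn_union_right _ d1]
    simp only [e1]
    rw [e3, e4]
    ring

theorem one_mul' (a : Gr G) : 1 * a = a := by
  ext I
  rw [mul_apply, Finset.sum_eq_single ∅]
  · simp [one_apply, sgn_empty_left]
  · intro J _ hJ; simp [one_apply, hJ]
  · simp

theorem mul_one' (a : Gr G) : a * 1 = a := by
  ext I
  rw [mul_apply, Finset.sum_eq_single I]
  · simp [one_apply, sgn_empty_right]
  · intro J hJ hne
    have : I \ J ≠ ∅ := fun e => hne ((Finset.mem_powerset.mp hJ).antisymm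
      (Finset.sdiff_eq_empty_iff_subset.mp e))
    simp [one_apply, this]
  · simp

noncomputable instance : Ring (Gr G) :=
  { (inferInstance : AddCommGroup (Gr G)), (inferInstance : Mul (Gr G)),
    (inferInstance : One (Gr G)) with
    left_distrib := fun a b c => by
      ext I; simp only [mul_apply, add_apply, mul_add, Finset.sum_add_distrib]
    right_distrib := fun a b c => by
      ext I; simp only [mul_apply, add_apply, mul_add, add_mul, Finset.sum_add_distrib]
    zero_mul := fun a => by ext I; simp [mul_apply, zero_apply]
    mul_zero := fun a => by ext I; simp [mul_apply, zero_apply]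
    mul_assoc := mul_assoc'
    one_mul := one_mul'
    mul_one := mul_one' }

noncomputable instance : Algebra ℂ (Gr G) :=
  Algebra.ofModule
    (fun c a b => by
      ext I; simp only [mul_apply, smul_apply, Finset.mul_sum]
      exact Finset.sum_congr rfl fun J _ => by ring)
    (fun c a b => by
      ext I; simp only [mul_apply, smul_apply, Finset.mul_sum]
      exact Finset.sum_congr rfl fun J _ => by ring)

/-- `a` is homogeneous of parity `p`. -/
def HasParity (p : ZMod 2) (a : Gr G) : Prop := ∀ I, (I.card : ZMod 2) ≠ p → a.coeff I = 0

/-- The parity `p` part of `a`. -/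
noncomputable def part (p : ZMod 2) (a : Gr G) : Gr G :=
  ⟨fun I => if (I.card : ZMod 2) = p then a.coeff I else 0⟩

theorem mul_swap (a b : Gr G) (c : ℂ)
    (h : ∀ J K : Finset G, a.coeff J ≠ 0 → b.coeff K ≠ 0 → (-1 : ℂ) ^ (J.card * K.card) = c) :
    b * a = c • (a * b) := by
  ext I
  rw [smul_apply, mul_apply, mul_apply, Finset.mul_sum]
  refine Finset.sum_bij' (fun J _ => I \ J) (fun J _ => I \ J) ?_ ?_ ?_ ?_ ?_
  · intro J _; simp
  · intro J _; simp
  · intro J hJ; simpa using Finset.mem_powerset.mp hJ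
  · intro J hJ; simpa using Finset.mem_powerset.mp hJ
  · intro J hJ
    have hs : I \ (I \ J) = J := by simpa using Finset.mem_powerset.mp hJ
    rw [hs]
    by_cases ha : a.coeff (I \ J) = 0
    · simp [ha]
    by_cases hb : b.coeff J = 0
    · simp [hb]
    rw [sgn_swap (J := I \ J) (K := J) Finset.sdiff_disjoint, h _ _ ha hb]
    ring

theorem HasParity.even_comm {a : Gr G} (ha : HasParity 0 a) (b : Gr G) : a * b = b * a := by
  have := mul_swap a b 1 (fun J K hJ _ => by
    have : (J.card : ZMod 2) = 0 := by by_contra h; exact hJ (ha J h)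
    have h2 : Even J.card := (ZMod.natCast_eq_zero_iff_even).mp this
    exact (h2.mul_right _).neg_one_pow)
  rw [this, one_smul]

theorem HasParity.odd_comm {a b : Gr G} (ha : HasParity 1 a) (hb : HasParity 1 b) :
    a * b = -(b * a) := by
  have := mul_swap a b (-1) (fun J K hJ hK => by
    have h1 : (J.card : ZMod 2) = 1 := by by_contra h; exact hJ (ha J h)
    have h2 : (K.card : ZMod 2) = 1 := by by_contra h; exact hK (hb K h)
    exact ((ZMod.natCast_eq_one_iff_odd.mp h1).mul (ZMod.natCast_eq_one_iff_odd.mp h2)).neg_one_pow)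
  rw [this, neg_smul, one_smul, neg_neg]

/-- The component of degree `0` in the last generator `⊤`. -/
def fnPart (a : Gr (WithTop ℕ)) : Gr ℕ :=
  ⟨fun I => a.coeff (I.map Function.Embedding.coeWithTop)⟩

/-- The coefficient of the last generator `⊤`, written to the left of that generator:
`a = fnPart a + barPart a * ⊤`. -/
def barPart (a : Gr (WithTop ℕ)) : Gr ℕ :=
  ⟨fun I => a.coeff (insert ⊤ (I.map Function.Embedding.coeWithTop))⟩

end Gr

/-! ### Forms on the cylinder

The cylinder is `ℂ / (z ∼ z + 1)`; functions on it are `1`-periodic functions on `ℂ`.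
The parameter algebra is `Gr ℕ`. Forms of type `(0,•)` with coefficients in the parameter
algebra are functions with values in `Gr (WithTop ℕ)`, the last generator `⊤` being `d z̄`. -/

/-- `(0,•)`-forms with parameters, before any smoothness is imposed. -/
abbrev SForm : Type := ℂ → Gr (WithTop ℕ)

/-- The Wirtinger derivative `∂f/∂z = (∂f/∂x - i ∂f/∂y) / 2`. -/
noncomputable def wirtinger (f : ℂ → ℂ) (z : ℂ) : ℂ :=
  (fderiv ℝ f z 1 - Complex.I * fderiv ℝ f z Complex.I) / 2

/-- The Wirtinger derivative `∂f/∂z̄ = (∂f/∂x + i ∂f/∂y) / 2`. -/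
noncomputable def wirtingerBar (f : ℂ → ℂ) (z : ℂ) : ℂ :=
  (fderiv ℝ f z 1 + Complex.I * fderiv ℝ f z Complex.I) / 2

/-- `∂_z` on forms, coefficient by coefficient. -/
noncomputable def SForm.dz (F : SForm) : SForm := fun z => ⟨fun I => wirtinger (fun w => (F w).coeff I) z⟩

/-- Smooth forms on the cylinder. -/
structure SForm.IsSmooth (F : SForm) : Prop where
  contDiff : ∀ I, ContDiff ℝ ∞ (fun z => (F z).coeff I)
  periodic : ∀ z, F (z + 1) = F z

/-- The form takes values in the augmentation ideal of the parameter algebra. -/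
def SForm.IsInfinitesimal (F : SForm) : Prop := ∀ z, (F z).coeff ∅ = 0 ∧ (F z).coeff {⊤} = 0

/-- Each coefficient has compact support on the cylinder. -/
def SForm.IsCompactlySupported (F : SForm) : Prop :=
  ∀ I, ∃ M : ℝ, ∀ z : ℂ, M < |z.im| → (F z).coeff I = 0

/-- `∮_C dz f` over the circle `C = {z ∈ [0,1]}`. -/
noncomputable def currentIntegral (f : ℂ → Gr ℕ) : Gr ℕ :=
  ⟨fun I => ∫ x in (0 : ℝ)..1, (f (x : ℂ)).coeff I⟩

/-- The integral of `f dz ∧ d z̄` over the cylinder, where `dz ∧ d z̄ = -2i dx ∧ dy`. -/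
noncomputable def cylinderIntegral (f : ℂ → Gr ℕ) : Gr ℕ :=
  ⟨fun I => -2 * Complex.I * ∫ x in (0 : ℝ)..1, ∫ y : ℝ, (f ⟨x, y⟩).coeff I⟩

/-! ### The formal differential superalgebra -/

/-- The symbols `∂_z^m λ^α_k` and `∂_z^m ρ^α_k`. -/
inductive JetVar (ι : Type) : Type
  | lam (α : ι) (k m : ℕ) : JetVar ι
  | rho (α : ι) (k m : ℕ) : JetVar ι

/-- The `λ`'s commute with everything, the `ρ`'s anticommute with each other. -/
inductive JetRel (ι : Type) : FreeAlgebra ℂ (JetVar ι) → FreeAlgebra ℂ (JetVar ι) → Prop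
  | even (α : ι) (k m : ℕ) (v : JetVar ι) :
      JetRel ι (FreeAlgebra.ι ℂ (.lam α k m) * FreeAlgebra.ι ℂ v)
        (FreeAlgebra.ι ℂ v * FreeAlgebra.ι ℂ (.lam α k m))
  | odd (α β : ι) (k l m n : ℕ) :
      JetRel ι (FreeAlgebra.ι ℂ (.rho α k m) * FreeAlgebra.ι ℂ (.rho β l n))
        (-(FreeAlgebra.ι ℂ (.rho β l n) * FreeAlgebra.ι ℂ (.rho α k m)))

/-- Polynomials in the `∂_z^m λ^α_k` (even) and `∂_z^m ρ^α_k` (odd): the free supercommutative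
algebra on these symbols. -/
abbrev JetPoly (ι : Type) : Type := RingQuot (JetRel ι)

namespace JetPoly

variable {ι : Type}

/-- The generators. -/
noncomputable def gen (v : JetVar ι) : JetPoly ι :=
  RingQuot.mkAlgHom ℂ (JetRel ι) (FreeAlgebra.ι ℂ v)

theorem gen_lam_comm (α : ι) (k m : ℕ) (v : JetVar ι) :
    gen (.lam α k m) * gen v = gen v * gen (.lam α k m) := by
  simpa [gen] using RingQuot.mkAlgHom_rel ℂ (JetRel.even α k m v)

theorem gen_rho_comm (α β : ι) (k l m n : ℕ) :
    gen (.rho α k m) * gen (.rho β l n) = -(gen (.rho β l n) * gen (.rho α k m)) := by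
  simpa [gen] using RingQuot.mkAlgHom_rel ℂ (JetRel.odd α β k l m n)

/-- An algebra map out of the polynomials. -/
noncomputable def lift {A : Type} [Ring A] [Algebra ℂ A] (f : JetVar ι → A)
    (he : ∀ α k m v, f (.lam α k m) * f v = f v * f (.lam α k m))
    (ho : ∀ α β k l m n, f (.rho α k m) * f (.rho β l n) = -(f (.rho β l n) * f (.rho α k m))) :
    JetPoly ι →ₐ[ℂ] A :=
  RingQuot.liftAlgHom ℂ ⟨FreeAlgebra.lift ℂ f, by
    intro x y h
    cases h with
    | even α k m v => simpa using he α k m v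
    | odd α β k l m n => simpa using ho α β k l m n⟩

theorem lift_gen {A : Type} [Ring A] [Algebra ℂ A] (f : JetVar ι → A) (he) (ho) (v : JetVar ι) :
    lift f he ho (gen v) = f v := by
  simp [lift, gen]

/-- The even derivation with prescribed values `d v` on the generators, obtained from the
algebra map `v ↦ v + ε d v` into the dual numbers over the polynomials. -/
noncomputable def derivationOf (d : JetVar ι → JetPoly ι)
    (he : ∀ α k m v, gen (.lam α k m) * d v + d (.lam α k m) * gen v =
      gen v * d (.lam α k m) + d v * gen (.lam α k m))
    (ho : ∀ α β k l m n, gen (.rho α k m) * d (.rho β l n) + d (.rho α k m) * gen (.rho β l n) =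
      -(gen (.rho β l n) * d (.rho α k m) + d (.rho β l n) * gen (.rho α k m))) :
    JetPoly ι →ₗ[ℂ] JetPoly ι where
  toFun x := (lift (A := TrivSqZeroExt (JetPoly ι) (JetPoly ι))
    (fun v => TrivSqZeroExt.inl (gen v) + TrivSqZeroExt.inr (d v))
    (fun α k m v => by
      ext
      · simpa using gen_lam_comm α k m v
      · simpa using he α k m v)
    (fun α β k l m n => by
      ext
      · simpa using gen_rho_comm α β k l m n
      · simpa using ho α β k l m n) x).snd
  map_add' x y := by simp
  map_smul' c x := by simp

section derivation

variable (d : JetVar ι → JetPoly ι) (he) (ho)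

theorem derivationOf_gen (v : JetVar ι) : derivationOf d he ho (gen v) = d v := by
  simp [derivationOf, lift_gen]

theorem derivationOf_algebraMap (c : ℂ) : derivationOf d he ho (algebraMap ℂ _ c) = 0 := by
  simp only [derivationOf, LinearMap.coe_mk, AddHom.coe_mk, AlgHom.commutes]
  simp [TrivSqZeroExt.algebraMap_eq_inl']

theorem derivationOf_mul (x y : JetPoly ι) :
    derivationOf d he ho (x * y) = x * derivationOf d he ho y + derivationOf d he ho x * y := by
  have key : ∀ (f : JetVar ι → TrivSqZeroExt (JetPoly ι) (JetPoly ι)) (he') (ho')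
      (z : JetPoly ι), (∀ v, (f v).fst = gen v) → (lift f he' ho' z).fst = z := by
    intro f he' ho' z hf
    have : (TrivSqZeroExt.fstHom ℂ (JetPoly ι) (JetPoly ι)).comp (lift f he' ho') =
        AlgHom.id ℂ (JetPoly ι) := by
      apply RingQuot.ringQuot_ext'
      apply FreeAlgebra.hom_ext
      funext v
      have := hf v
      have h2 := lift_gen f he' ho' v
      simp only [gen] at this h2
      simp [h2, this]
    exact DFunLike.congr_fun this z
  simp only [derivationOf, LinearMap.coe_mk, AddHom.coe_mk, map_mul, TrivSqZeroExt.snd_mul]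
  rw [key _ _ _ x (by simp), key _ _ _ y (by simp)]
  simp

end derivation

/-- `∂_z` on polynomials. -/
noncomputable def dz : JetPoly ι →ₗ[ℂ] JetPoly ι :=
  derivationOf
    (fun v => match v with
      | .lam α k m => gen (.lam α k (m + 1))
      | .rho α k m => gen (.rho α k (m + 1)))
    (by
      intro α k m v
      cases v <;> rw [gen_lam_comm α k m, gen_lam_comm α k (m + 1), add_comm])
    (by
      intro α β k l m n
      simp only [gen_rho_comm α β k l m, gen_rho_comm α β k l (m + 1)]
      abel)

open Classical in
/-- The partial derivative `∂ / ∂(∂_z^m λ^α_0)`. -/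
noncomputable def pderiv (α : ι) (m : ℕ) : JetPoly ι →ₗ[ℂ] JetPoly ι :=
  derivationOf (fun v => if v = .lam α 0 m then 1 else 0)
    (by intro α' k' m' v; split_ifs <;> simp [add_comm])
    (by intros; simp)

/-- The span of the generators. -/
noncomputable def genSpan (ι : Type) : Submodule ℂ (JetPoly ι) :=
  Submodule.span ℂ (Set.range gen)

theorem dz_mem (n : ℕ) {x : JetPoly ι} (hx : x ∈ genSpan ι ^ n) : dz x ∈ genSpan ι ^ n := by
  induction n generalizing x with
  | zero =>
    rw [pow_zero] at hx
    obtain ⟨c, rfl⟩ := Submodule.mem_one.mp hx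
    rw [dz, derivationOf_algebraMap]
    exact zero_mem _
  | succ n ih =>
    rw [pow_succ'] at hx ⊢
    refine Submodule.mul_induction_on hx ?_ ?_
    · intro a ha b hb
      rw [dz, derivationOf_mul]
      refine add_mem (Submodule.mul_mem_mul ha (ih hb)) (Submodule.mul_mem_mul ?_ hb)
      refine Submodule.span_induction (p := fun a _ => dz a ∈ genSpan ι) ?_ ?_ ?_ ?_ ha
      · rintro _ ⟨v, rfl⟩
        rw [dz, derivationOf_gen]
        cases v <;> exact Submodule.subset_span ⟨_, rfl⟩
      · simp
      · intro a b _ _ ha hb; rw [map_add]; exact add_mem ha hb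
      · intro c a _ ha; rw [map_smul]; exact Submodule.smul_mem _ c ha
    · intro a b ha hb; rw [map_add]; exact add_mem ha hb

theorem pderiv_mem (α : ι) (m n : ℕ) {x : JetPoly ι} (hx : x ∈ genSpan ι ^ (n + 1)) :
    pderiv α m x ∈ genSpan ι ^ n := by
  have hone : ∀ a ∈ genSpan ι, pderiv α m a ∈ (1 : Submodule ℂ (JetPoly ι)) := by
    intro a ha
    refine Submodule.span_induction (p := fun a _ => pderiv α m a ∈ (1 : Submodule ℂ (JetPoly ι)))
      ?_ ?_ ?_ ?_ ha
    · rintro _ ⟨v, rfl⟩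
      rw [pderiv, derivationOf_gen]
      split_ifs
      · exact Submodule.one_le.mp le_rfl
      · exact zero_mem _
    · simp
    · intro a b _ _ ha hb; rw [map_add]; exact add_mem ha hb
    · intro c a _ ha; rw [map_smul]; exact Submodule.smul_mem _ c ha
  induction n generalizing x with
  | zero =>
    rw [zero_add, pow_one] at hx
    rw [pow_zero]
    exact hone x hx
  | succ n ih =>
    rw [pow_succ'] at hx
    refine Submodule.mul_induction_on hx ?_ ?_
    · intro a ha b hb
      rw [pderiv, derivationOf_mul]
      refine add_mem ?_ ?_
      · rw [pow_succ']; exact Submodule.mul_mem_mul ha (ih hb)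
      · have := Submodule.mul_mem_mul (hone a ha) hb
        rwa [one_mul] at this
    · intro a b ha hb; rw [map_add]; exact add_mem ha hb

theorem neg_dz_pow_mem (k n : ℕ) {x : JetPoly ι} (hx : x ∈ genSpan ι ^ n) :
    ((-dz) ^ k : Module.End ℂ (JetPoly ι)) x ∈ genSpan ι ^ n := by
  induction k with
  | zero => simpa using hx
  | succ k ih =>
    rw [pow_succ', Module.End.mul_apply, LinearMap.neg_apply]
    exact neg_mem (dz_mem n ih)

end JetPoly

/-- Power series in the `∂_z^m λ^α_k` and `∂_z^m ρ^α_k`: a series is the sequence of its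
homogeneous components, the one of degree `n` being a polynomial of degree `n`. -/
structure JetSeries (ι : Type) where
  coeff : ℕ → JetPoly ι
  homog : ∀ n, coeff n ∈ JetPoly.genSpan ι ^ n

namespace JetSeries

variable {ι : Type}

/-- `∂_z L`. -/
noncomputable def dz (L : JetSeries ι) : JetSeries ι where
  coeff n := JetPoly.dz (L.coeff n)
  homog n := JetPoly.dz_mem n (L.homog n)

/-- `∑_k (-∂_z)^k (∂L / ∂(∂_z^k λ^α_0))`; in each degree only finitely many terms are nonzero. -/
noncomputable def euler (α : ι) (L : JetSeries ι) : JetSeries ι where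
  coeff n := ∑ᶠ k : ℕ, ((-JetPoly.dz) ^ k : Module.End ℂ (JetPoly ι))
    (JetPoly.pderiv α k (L.coeff (n + 1)))
  homog n := finsum_induction (fun x => x ∈ JetPoly.genSpan ι ^ n) (zero_mem _)
    (fun _ _ => add_mem)
    (fun k => JetPoly.neg_dz_pow_mem k n (JetPoly.pderiv_mem α k n (L.homog (n + 1))))

/-- The variational bracket
`∑_{α,β,k,m} ((-∂_z)^k ∂L₁/∂(∂_z^k λ^α_0)) g^{αβ} ∂_z ((-∂_z)^m ∂L₂/∂(∂_z^m λ^β_0))`,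
where `g^{αβ}` is the inverse matrix of `g`. -/
noncomputable def bracket [Fintype ι] [DecidableEq ι] (g : Matrix ι ι ℂ) (L₁ L₂ : JetSeries ι) :
    JetSeries ι where
  coeff n := ∑ α, ∑ β, g⁻¹ α β • ∑ ij ∈ Finset.HasAntidiagonal.antidiagonal n,
    (euler α L₁).coeff ij.1 * (euler β L₂).dz.coeff ij.2
  homog n := by
    refine sum_mem fun α _ => sum_mem fun β _ => Submodule.smul_mem _ _ (sum_mem fun ij h => ?_)
    rw [← Finset.HasAntidiagonal.mem_antidiagonal.mp h, pow_add]
    exact Submodule.mul_mem_mul ((euler α L₁).homog _) ((euler β L₂).dz.homog _)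

end JetSeries

/-! ### Fields and functionals

Formal functions on the graded space of fields are described by their values on points with
parameters: a point is an even element of (fields) ⊗ (augmentation ideal of `Gr ℕ`). As `Gr ℕ`
has infinitely many odd generators, these values determine every Taylor component. -/

/-- A field `μ = ∑ (λ^α_k ⊗ O_α t^k + ρ^α_k ∂_z ⊗ O_α t^k)` with parameters. The vector `∂_z` is
odd, so that an even field has even `λ^α_k` and odd `ρ^α_k`. -/
structure FieldPoint (ι : Type) where
  lam : ι → ℕ → SForm
  rho : ι → ℕ → SForm
  lam_even : ∀ α k z, Gr.HasParity 0 (lam α k z)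
  rho_odd : ∀ α k z, Gr.HasParity 1 (rho α k z)
  lam_smooth : ∀ α k, (lam α k).IsSmooth
  rho_smooth : ∀ α k, (rho α k).IsSmooth
  lam_inf : ∀ α k, (lam α k).IsInfinitesimal
  rho_inf : ∀ α k, (rho α k).IsInfinitesimal

theorem SForm.dz_parity {F : SForm} {p : ZMod 2} (h : ∀ z, Gr.HasParity p (F z)) (m : ℕ) (z : ℂ) :
    Gr.HasParity p (SForm.dz^[m] F z) := by
  induction m generalizing z with
  | zero => exact h z
  | succ m ih =>
    intro I hI
    rw [Function.iterate_succ_apply']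
    have : (fun w => (SForm.dz^[m] F w).coeff I) = fun _ => (0 : ℂ) := funext fun w => ih w I hI
    simp [SForm.dz, this, wirtinger]

namespace FieldPoint

variable {ι : Type}

/-- The values of the symbols on a field. -/
noncomputable def evalVar (φ : FieldPoint ι) : JetVar ι → SForm
  | .lam α k m => SForm.dz^[m] (φ.lam α k)
  | .rho α k m => SForm.dz^[m] (φ.rho α k)

/-- The value of a polynomial in the symbols on a field. -/
noncomputable def eval (φ : FieldPoint ι) : JetPoly ι →ₐ[ℂ] SForm :=
  JetPoly.lift φ.evalVar
    (fun α k m v => funext fun z =>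
      (SForm.dz_parity (fun z => φ.lam_even α k z) m z : Gr.HasParity 0
        (φ.evalVar (.lam α k m) z)).even_comm (φ.evalVar v z))
    (fun α β k l m n => funext fun z =>
      (SForm.dz_parity (fun z => φ.rho_odd α k z) m z : Gr.HasParity 1
        (φ.evalVar (.rho α k m) z)).odd_comm
        (SForm.dz_parity (fun z => φ.rho_odd β l z) n z :
          Gr.HasParity 1 (φ.evalVar (.rho β l n) z)))

/-- The value `L(∂_z^m λ^α_k, ∂_z^m ρ^α_k)` of a power series on a field, a `(0,•)`-form.
Since the field is infinitesimal, only the terms of degree at most the size of `I` contribute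
to the coefficient `I`. -/
noncomputable def evalSeries (φ : FieldPoint ι) (L : JetSeries ι) : SForm :=
  fun z => ⟨fun I => ∑ᶠ n : ℕ, (φ.eval (L.coeff n) z).coeff I⟩

theorem isSmooth_add {F K : SForm} (hF : F.IsSmooth) (hK : K.IsSmooth) (c : ℂ) :
    SForm.IsSmooth (fun z => F z + c • K z) where
  contDiff I := (hF.contDiff I).add (contDiff_const.mul (hK.contDiff I))
  periodic z := by rw [hF.periodic, hK.periodic]

theorem isInfinitesimal_add {F K : SForm} (hF : F.IsInfinitesimal) (hK : K.IsInfinitesimal)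
    (c : ℂ) : SForm.IsInfinitesimal (fun z => F z + c • K z) := fun z => by
  simp [Gr.add_apply, Gr.smul_apply, hF z, hK z]

/-- The field `φ + s ψ`. -/
noncomputable def shift (φ ψ : FieldPoint ι) (s : ℝ) : FieldPoint ι where
  lam α k z := φ.lam α k z + (s : ℂ) • ψ.lam α k z
  rho α k z := φ.rho α k z + (s : ℂ) • ψ.rho α k z
  lam_even α k z I hI := by
    rw [Gr.add_apply, Gr.smul_apply, φ.lam_even α k z I hI, ψ.lam_even α k z I hI, mul_zero,
      add_zero]
  rho_odd α k z I hI := by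
    rw [Gr.add_apply, Gr.smul_apply, φ.rho_odd α k z I hI, ψ.rho_odd α k z I hI, mul_zero,
      add_zero]
  lam_smooth α k := isSmooth_add (φ.lam_smooth α k) (ψ.lam_smooth α k) s
  rho_smooth α k := isSmooth_add (φ.rho_smooth α k) (ψ.rho_smooth α k) s
  lam_inf α k := isInfinitesimal_add (φ.lam_inf α k) (ψ.lam_inf α k) s
  rho_inf α k := isInfinitesimal_add (φ.rho_inf α k) (ψ.rho_inf α k) s

/-- Compactly supported fields. -/
def IsCompactlySupported (φ : FieldPoint ι) : Prop :=
  ∀ α k, (φ.lam α k).IsCompactlySupported ∧ (φ.rho α k).IsCompactlySupported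

/-- The only nonzero components of `ψ` are the `λ^α_0`, and these are `v α`. -/
def IsAlong (ψ : FieldPoint ι) (v : ι → SForm) : Prop :=
  (∀ α, ψ.lam α 0 = v α) ∧ (∀ α k, ψ.lam α (k + 1) = 0) ∧ ∀ α k, ψ.rho α k = 0

/-- The field is `∂̄`-closed on a neighbourhood of the circle `C`: the functions (form degree
zero components) in it are holomorphic there. -/
def IsHolomorphicNearCircle (φ : FieldPoint ι) : Prop :=
  ∃ ε > 0, ∀ α k I, ∀ z : ℂ, |z.im| < ε →
    wirtingerBar (fun w => (φ.lam α k w).fnPart.coeff I) z = 0 ∧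
    wirtingerBar (fun w => (φ.rho α k w).fnPart.coeff I) z = 0

end FieldPoint

section functionals

variable {ι : Type}

/-- `∮_C J_L^{(1)}`: the `1`-form part of `J_L = dz L` is `dz` times the function part of `L`. -/
noncomputable def currentObservable (L : JetSeries ι) (φ : FieldPoint ι) : Gr ℕ :=
  currentIntegral fun z => (φ.evalSeries L z).fnPart

/-- `∫ J_L^{(2)}` over the cylinder: the `2`-form part of `J_L = dz L` is `dz` times the
`d z̄` part of `L`. It is a functional on compactly supported fields. -/
noncomputable def localFunctional (L : JetSeries ι) (φ : FieldPoint ι) : Gr ℕ :=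
  cylinderIntegral fun z => (φ.evalSeries L z).barPart

/-- `X α` is the variational derivative at `φ` of `S = ∫ J_L^{(2)}` with respect to `λ^α_0`: the
variation of `S` in each compactly supported direction `δλ_0` is `∑_α ∫ dz δλ^α_0 X_α`.
As `φ` need not have compact support, `S(φ + s δφ) - S(φ)` is the integral of the difference of
the densities. -/
def IsVariationalDerivative [Fintype ι] (L : JetSeries ι) (φ : FieldPoint ι) (X : ι → SForm) :
    Prop :=
  (∀ α, (X α).IsSmooth) ∧
  ∀ (δφ : FieldPoint ι) (v : ι → SForm), δφ.IsAlong v → δφ.IsCompactlySupported → ∀ I,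
    HasDerivAt
      (fun s : ℝ => (cylinderIntegral
        fun z => ((φ.shift δφ s).evalSeries L z - φ.evalSeries L z).barPart).coeff I)
      ((cylinderIntegral fun z => (∑ α, v α z * X α z).barPart).coeff I) 0

/-- The Hamiltonian vector field: the contraction of the variational derivative `X_α(z)` with the
first leg of the BV kernel `∑ g^{αβ} (O_α ⊗ O_β) ∂_z δ(z - w) (d z̄ - d w̄)`. The kernel is a
multiple of `t^0` in each leg and pairs only the `λ_0`'s, and integrating `X_α(z)` against
`∂_z δ(z - w)` gives `-∂_w X_α(w)`; so `δ_S λ^β_0 = -∑_α g^{αβ} ∂_z X_α`, and `δ_S` is zero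
on the other components. -/
noncomputable def hamiltonianField [Fintype ι] [DecidableEq ι] (g : Matrix ι ι ℂ)
    (X : ι → SForm) : ι → SForm :=
  fun β z => -∑ α, g⁻¹ α β • SForm.dz (X α) z

/-- `D` is the derivative at `φ` of the observable `O` along the vector `V` (a value of a vector
field with components only in the directions `λ_0`). The parts of `V` of parity `p` are treated
separately: for each parameter `a` of parity `p` the vector `a V^p` is even, and the derivative of
`O` along it is `a` times the derivative along `V^p`. -/
def HasDerivativeAlong (O : FieldPoint ι → Gr ℕ) (φ : FieldPoint ι) (V : ι → SForm) (D : Gr ℕ) :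
    Prop :=
  ∃ D' : ZMod 2 → Gr ℕ, D = D' 0 + D' 1 ∧
    ∀ (p : ZMod 2) (a : Gr (WithTop ℕ)) (ψ : FieldPoint ι), a.barPart = 0 → a.HasParity p →
      ψ.IsAlong (fun α z => a * (V α z).part p) → ∀ I,
      HasDerivAt (fun s : ℝ => (O (φ.shift ψ s)).coeff I) ((a.fnPart * D' p).coeff I) 0

/-- `D` is the value at `φ` of the BV bracket `{∫ J_L^{(2)}, O}_BV`, the derivative of `O` along
the Hamiltonian vector field of `∫ J_L^{(2)}`. -/
def IsBVBracket [Fintype ι] [DecidableEq ι] (g : Matrix ι ι ℂ) (L : JetSeries ι)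
    (O : FieldPoint ι → Gr ℕ) (φ : FieldPoint ι) (D : Gr ℕ) : Prop :=
  ∃ X : ι → SForm, IsVariationalDerivative L φ X ∧
    HasDerivativeAlong O φ (hamiltonianField g X) D

end functionals

/-! The bracket is the derivative of the second functional along the Hamiltonian vector field of the
first, so the theorem reduces to two integrations by parts. Write `E_α` for the Euler operator `∑_k
(-∂_z)^k ∂/∂(∂_z^k λ^α_0)`. In a compactly supported direction, the variation of the local
functional of `L₁` is `∑_α ∫ dz δλ^α_0 E_α(L₁)` (`isVariationalDerivative_euler`), so the vector
field has components `V^β = -∑_α g^{αβ} ∂_z E_α(L₁)`, again values of power series. The derivative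
of `L₂` along `V` is `∑_{β,m} ∂_z^m V^β · ∂L₂/∂(∂_z^m λ^β_0)`, which is `∑_β V^β E_β(L₂)` plus an
exact term. Moving the `∂_z` inside `V^β` over to `E_β(L₂)` absorbs the sign and gives `[L₁, L₂] +
∂_z M`, with an explicit `M` independent of the field. This is `JetPoly.sum_pderivSum_hamiltonian`
for polynomials and `linSeries_hamiltonianField` for series on fields.

Part (1) is this identity integrated over the circle. If the field is holomorphic near `C`, then
`∂_z M` agrees on `C` with the `x`-derivative of a periodic function and integrates to zero. In part
(2) the exact term vanishes by Stokes on the cylinder.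

Power series cause no convergence problem: the field is infinitesimal, so a polynomial of degree `n`
has no coefficient of Grassmann degree below `n` (`FieldPoint.eval_vanishesBelow`), and each
coefficient depends on one finite truncation. Derivatives in the parameter `s` come from the exact
expansion `value + s · linear + s² · continuous`.

The bracket is characterised by a relation, so existence must be matched by uniqueness. Testing with
a bump function times a Grassmann monomial disjoint from a given index set isolates one coefficient
at a time (`IsVariationalDerivative.unique`, `HasDerivativeAlong.unique`). -/

namespace Gr

/-! ### Grassmann algebra: degree filtration, test monomials, splitting off `d z̄`. -/

theorem hasParity_part {G : Type} (p : ZMod 2) (a : Gr G) : (a.part p).HasParity p :=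
  fun I hI => by simp [part, hI]

section

variable {G : Type} [LinearOrder G]

theorem sum_apply {κ : Type*} (s : Finset κ) (f : κ → Gr G) (I : Finset G) :
    (∑ i ∈ s, f i).coeff I = ∑ i ∈ s, (f i).coeff I := by
  classical
  induction s using Finset.induction_on with
  | empty => simp [zero_apply]
  | insert a s ha ih => rw [Finset.sum_insert ha, Finset.sum_insert ha, add_apply, ih]

/-- Only splittings of `I` enter the product, so multiplication is local in the subsets of `I`. One
truncation degree chosen from `I` therefore serves both factors. -/
theorem mul_coeff_congr {a a' b b' : Gr G} {I : Finset G}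
    (ha : ∀ J ⊆ I, a.coeff J = a'.coeff J) (hb : ∀ J ⊆ I, b.coeff J = b'.coeff J) :
    (a * b).coeff I = (a' * b').coeff I := by
  rw [mul_apply, mul_apply]
  refine Finset.sum_congr rfl fun J hJ => ?_
  rw [ha J (Finset.mem_powerset.mp hJ), hb _ Finset.sdiff_subset]

theorem algebraMap_apply (c : ℂ) (I : Finset G) :
    (algebraMap ℂ (Gr G) c).coeff I = if I = ∅ then c else 0 := by
  rw [Algebra.algebraMap_eq_smul_one, smul_apply, one_apply]
  split_ifs <;> simp

/-- All coefficients of degree less than `n` vanish. -/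
def VanishesBelow (n : ℕ) (a : Gr G) : Prop := ∀ I, I.card < n → a.coeff I = 0

theorem VanishesBelow.mul {m n : ℕ} {a b : Gr G} (ha : a.VanishesBelow m)
    (hb : b.VanishesBelow n) : (a * b).VanishesBelow (m + n) := by
  intro I hI
  rw [mul_apply]
  refine Finset.sum_eq_zero fun J hJ => ?_
  have h := Finset.card_sdiff_add_card_eq_card (Finset.mem_powerset.mp hJ)
  rcases lt_or_ge J.card m with h1 | h1
  · rw [ha J h1, zero_mul, mul_zero]
  · rw [hb (I \ J) (by omega), mul_zero, mul_zero]

theorem sgn_ne_zero (J K : Finset G) : sgn J K ≠ 0 := by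
  refine Finset.prod_ne_zero_iff.mpr fun j _ => Finset.prod_ne_zero_iff.mpr fun k _ => ?_
  split_ifs <;> norm_num

/-- The ordered product of the generators in `K`. -/
noncomputable def monomial (K : Finset G) : Gr G := ⟨fun I => if I = K then 1 else 0⟩

theorem monomial_apply (K I : Finset G) : (monomial K).coeff I = if I = K then 1 else 0 := rfl

theorem monomial_mul_apply (K I : Finset G) (a : Gr G) :
    (monomial K * a).coeff I = if K ⊆ I then sgn K (I \ K) * a.coeff (I \ K) else 0 := by
  rw [mul_apply]
  split_ifs with h
  · rw [Finset.sum_eq_single K]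
    · simp [monomial_apply]
    · intro J _ hJ; simp [monomial_apply, hJ]
    · intro hK; exact absurd (Finset.mem_powerset.mpr h) hK
  · refine Finset.sum_eq_zero fun J hJ => ?_
    have : J ≠ K := fun e => h (e ▸ Finset.mem_powerset.mp hJ)
    simp [monomial_apply, this]

/-- The uniqueness proofs read off an arbitrary coefficient of `a` through this: up to a nonzero
sign it reappears at an index of any convenient shape. -/
theorem monomial_mul_apply_union {K J : Finset G} (h : Disjoint K J) (a : Gr G) :
    (monomial K * a).coeff (K ∪ J) = sgn K J * a.coeff J := by
  rw [monomial_mul_apply, if_pos Finset.subset_union_left, Finset.union_sdiff_cancel_left h]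

theorem HasParity.mul {p q : ZMod 2} {a b : Gr G} (ha : a.HasParity p) (hb : b.HasParity q) :
    (a * b).HasParity (p + q) := by
  intro I hI
  rw [mul_apply]
  refine Finset.sum_eq_zero fun J hJ => ?_
  have h := Finset.card_sdiff_add_card_eq_card (Finset.mem_powerset.mp hJ)
  by_cases h1 : (J.card : ZMod 2) = p
  · rw [hb (I \ J) fun h2 => hI (by rw [← h, Nat.cast_add, h1, h2, add_comm]), mul_zero, mul_zero]
  · rw [ha J h1, zero_mul, mul_zero]

theorem hasParity_monomial (K : Finset G) : (monomial K).HasParity (K.card : ZMod 2) := by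
  intro I hI
  rw [monomial_apply, if_neg]
  rintro rfl
  exact hI rfl

theorem part_zero_add_part_one (a : Gr G) : a.part 0 + a.part 1 = a := by
  ext I
  have : ∀ q : ZMod 2, q = 0 ∨ q = 1 := by decide
  rw [add_apply]
  rcases this (I.card : ZMod 2) with h | h <;> simp [part, h]

end

section WithTop

/-- The inclusion of the parameters into all generators. -/
abbrev emb : ℕ ↪ WithTop ℕ := Function.Embedding.coeWithTop

theorem exists_eq_map {S : Finset (WithTop ℕ)} (h : ⊤ ∉ S) : ∃ I : Finset ℕ, S = I.map emb := by
  have : S ⊆ (S.preimage emb emb.injective.injOn).map emb := by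
    intro x hx
    cases x with
    | top => exact absurd hx h
    | coe n =>
      rw [Finset.mem_map]
      exact ⟨n, Finset.mem_preimage.mpr hx, rfl⟩
  obtain ⟨I, -, hI⟩ := Finset.subset_map_iff.mp this
  exact ⟨I, hI⟩

theorem exists_eq_insert_map {S : Finset (WithTop ℕ)} (h : ⊤ ∈ S) :
    ∃ I : Finset ℕ, S = insert ⊤ (I.map emb) := by
  obtain ⟨I, hI⟩ := exists_eq_map (Finset.notMem_erase ⊤ S)
  exact ⟨I, by rw [← hI, Finset.insert_erase h]⟩

theorem top_notMem_map (I : Finset ℕ) : (⊤ : WithTop ℕ) ∉ I.map emb := by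
  simp

theorem sgn_map (J K : Finset ℕ) : sgn (J.map emb) (K.map emb) = sgn J K := by
  simp [sgn]

theorem sum_powerset_map (I : Finset ℕ) (f : Finset (WithTop ℕ) → ℂ) :
    ∑ J ∈ (I.map emb).powerset, f J = ∑ J ∈ I.powerset, f (J.map emb) := by
  symm
  refine Finset.sum_bij (fun J _ => J.map emb) ?_ ?_ ?_ ?_
  · intro J hJ
    exact Finset.mem_powerset.mpr (Finset.map_subset_map.mpr (Finset.mem_powerset.mp hJ))
  · intro J _ K _ h; exact Finset.map_injective _ h
  · intro S hS
    obtain ⟨J, hJ, rfl⟩ := Finset.subset_map_iff.mp (Finset.mem_powerset.mp hS)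
    exact ⟨J, Finset.mem_powerset.mpr hJ, rfl⟩
  · intro J _; rfl

theorem fnPart_apply (a : Gr (WithTop ℕ)) (I : Finset ℕ) :
    a.fnPart.coeff I = a.coeff (I.map emb) := rfl

theorem barPart_apply (a : Gr (WithTop ℕ)) (I : Finset ℕ) :
    a.barPart.coeff I = a.coeff (insert ⊤ (I.map emb)) := rfl

theorem fnPart_mul (a b : Gr (WithTop ℕ)) : (a * b).fnPart = a.fnPart * b.fnPart := by
  ext I
  rw [fnPart_apply, mul_apply, mul_apply, sum_powerset_map]
  refine Finset.sum_congr rfl fun J _ => ?_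
  rw [← Finset.map_sdiff, sgn_map, fnPart_apply, fnPart_apply]

/-- Since `⊤` is the largest generator, it already stands rightmost and splitting it off the right
factor costs no sign. The hypothesis kills the splittings that take `⊤` from `a`. -/
theorem barPart_mul {a : Gr (WithTop ℕ)} (ha : a.barPart = 0) (b : Gr (WithTop ℕ)) :
    (a * b).barPart = a.fnPart * b.barPart := by
  ext I
  rw [barPart_apply, mul_apply, mul_apply, Finset.sum_powerset_insert (top_notMem_map I),
    sum_powerset_map, sum_powerset_map]
  have h0 : ∀ J : Finset ℕ, a.coeff (insert ⊤ (J.map emb)) = 0 := fun J => by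
    rw [← barPart_apply, ha, zero_apply]
  simp only [h0, zero_mul, mul_zero, Finset.sum_const_zero, add_zero]
  refine Finset.sum_congr rfl fun J _ => ?_
  have e : insert ⊤ (I.map emb) \ J.map emb = insert ⊤ ((I \ J).map emb) := by
    rw [Finset.insert_sdiff_of_notMem _ (top_notMem_map J), Finset.map_sdiff]
  have e2 : sgn (J.map emb) (insert ⊤ ((I \ J).map emb)) = sgn J (I \ J) := by
    rw [Finset.insert_eq, sgn_union_right _ (by simp), sgn_map]
    simp [sgn]
  rw [e, e2, fnPart_apply, barPart_apply]

end WithTop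

end Gr

/-! ### Formal variational calculus on polynomials. -/

namespace JetPoly

variable {ι : Type}

theorem induction {P : JetPoly ι → Prop} (algebraMap : ∀ c, P (algebraMap ℂ _ c))
    (gen : ∀ v, P (gen v)) (mul : ∀ x y, P x → P y → P (x * y))
    (add : ∀ x y, P x → P y → P (x + y)) (x : JetPoly ι) : P x := by
  obtain ⟨y, rfl⟩ := RingQuot.mkAlgHom_surjective ℂ (JetRel ι) x
  induction y with
  | grade0 c => rw [AlgHom.commutes]; exact algebraMap c
  | grade1 v => exact gen v
  | mul a b ha hb => rw [map_mul]; exact mul _ _ ha hb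
  | add a b ha hb => rw [map_add]; exact add _ _ ha hb

theorem dz_mul (x y : JetPoly ι) : dz (x * y) = x * dz y + dz x * y := derivationOf_mul _ _ _ _ _

theorem dz_algebraMap (c : ℂ) : dz (algebraMap ℂ (JetPoly ι) c) = 0 :=
  derivationOf_algebraMap _ _ _ _

theorem dz_lam (α : ι) (k m : ℕ) : dz (gen (.lam α k m)) = gen (.lam α k (m + 1)) :=
  derivationOf_gen _ _ _ _

theorem dz_rho (α : ι) (k m : ℕ) : dz (gen (.rho α k m)) = gen (.rho α k (m + 1)) :=
  derivationOf_gen _ _ _ _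

theorem pderiv_mul (α : ι) (m : ℕ) (x y : JetPoly ι) :
    pderiv α m (x * y) = x * pderiv α m y + pderiv α m x * y := derivationOf_mul _ _ _ _ _

theorem pderiv_algebraMap (α : ι) (m : ℕ) (c : ℂ) :
    pderiv α m (algebraMap ℂ (JetPoly ι) c) = 0 := derivationOf_algebraMap _ _ _ _

open Classical in
theorem pderiv_gen (α : ι) (m : ℕ) (v : JetVar ι) :
    pderiv α m (gen v) = if v = .lam α 0 m then 1 else 0 := derivationOf_gen _ _ _ _

/-- A polynomial involves finitely many symbols, so its jet order is bounded. -/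
theorem exists_pderiv_eq_zero (x : JetPoly ι) : ∃ K, ∀ α m, K ≤ m → pderiv α m x = 0 := by
  induction x using induction with
  | algebraMap c => exact ⟨0, fun α m _ => pderiv_algebraMap α m c⟩
  | gen v =>
    cases v with
    | lam β k n =>
      refine ⟨n + 1, fun α m hm => ?_⟩
      rw [pderiv_gen, if_neg]
      intro h
      injection h with h1 h2 h3
      omega
    | rho β k n => exact ⟨0, fun α m _ => by rw [pderiv_gen, if_neg (by simp)]⟩
  | mul x y hx hy =>
    obtain ⟨K, hK⟩ := hx
    obtain ⟨K', hK'⟩ := hy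
    exact ⟨max K K', fun α m hm => by
      rw [pderiv_mul, hK α m (by omega), hK' α m (by omega), mul_zero, zero_mul, add_zero]⟩
  | add x y hx hy =>
    obtain ⟨K, hK⟩ := hx
    obtain ⟨K', hK'⟩ := hy
    exact ⟨max K K', fun α m hm => by
      rw [map_add, hK α m (by omega), hK' α m (by omega), add_zero]⟩

/-- The bound is chosen before `M`, `α` and `T` and may be enlarged freely, so several such sums can
be rewritten over one common range. -/
theorem exists_finsum_pderiv_eq (x : JetPoly ι) : ∃ K, ∀ N, K ≤ N →
    ∀ {M : Type} [AddCommMonoid M] [Module ℂ M] (α : ι) (T : ℕ → JetPoly ι →ₗ[ℂ] M),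
      ∑ᶠ m : ℕ, T m (pderiv α m x) = ∑ m ∈ Finset.range N, T m (pderiv α m x) := by
  obtain ⟨K, hK⟩ := exists_pderiv_eq_zero x
  refine ⟨K, fun N hN M _ _ α T => finsum_eq_sum_of_support_subset _ fun m hm => ?_⟩
  simp only [Finset.coe_range, Set.mem_Iio]
  by_contra h
  refine hm ?_
  change T m (pderiv α m x) = 0
  rw [hK α m (by omega), map_zero]

/-- A sum `∑_m T_m (∂x / ∂(∂_z^m λ^α_0))`, which has finitely many nonzero terms. -/
noncomputable def pderivSum {M : Type} [AddCommMonoid M] [Module ℂ M] (α : ι)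
    (T : ℕ → JetPoly ι →ₗ[ℂ] M) : JetPoly ι →ₗ[ℂ] M where
  toFun x := ∑ᶠ m : ℕ, T m (pderiv α m x)
  map_add' x y := by
    obtain ⟨K, hK⟩ := exists_finsum_pderiv_eq x
    obtain ⟨K', hK'⟩ := exists_finsum_pderiv_eq y
    obtain ⟨K'', hK''⟩ := exists_finsum_pderiv_eq (x + y)
    rw [hK (max K (max K' K'')) (by omega), hK' (max K (max K' K'')) (by omega),
      hK'' (max K (max K' K'')) (by omega), ← Finset.sum_add_distrib]
    simp
  map_smul' c x := by
    obtain ⟨K, hK⟩ := exists_finsum_pderiv_eq x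
    obtain ⟨K', hK'⟩ := exists_finsum_pderiv_eq (c • x)
    rw [hK (max K K') (by omega), hK' (max K K') (by omega)]
    simp [Finset.smul_sum]

theorem exists_pderivSum_eq (x : JetPoly ι) : ∃ K, ∀ N, K ≤ N →
    ∀ {M : Type} [AddCommMonoid M] [Module ℂ M] (α : ι) (T : ℕ → JetPoly ι →ₗ[ℂ] M),
      pderivSum α T x = ∑ m ∈ Finset.range N, T m (pderiv α m x) :=
  exists_finsum_pderiv_eq x

theorem pderivSum_mem {M : Type} [AddCommMonoid M] [Module ℂ M] (α : ι)
    (T : ℕ → JetPoly ι →ₗ[ℂ] M) {n : ℕ} {S : Submodule ℂ M}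
    (hT : ∀ m, ∀ x ∈ genSpan ι ^ n, T m x ∈ S) {x : JetPoly ι} (hx : x ∈ genSpan ι ^ (n + 1)) :
    pderivSum α T x ∈ S :=
  finsum_induction (fun x => x ∈ S) (zero_mem _) (fun _ _ => add_mem)
    (fun m => hT m _ (pderiv_mem α m n hx))

theorem pderivSum_algebraMap {M : Type} [AddCommMonoid M] [Module ℂ M] (α : ι)
    (T : ℕ → JetPoly ι →ₗ[ℂ] M) (c : ℂ) : pderivSum α T (algebraMap ℂ _ c) = 0 := by
  simp [pderivSum, pderiv_algebraMap]

/-- The Euler operator. -/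
noncomputable def euler (α : ι) : JetPoly ι →ₗ[ℂ] JetPoly ι := pderivSum α fun k => (-dz) ^ k

theorem euler_mem (α : ι) {n : ℕ} {x : JetPoly ι} (hx : x ∈ genSpan ι ^ (n + 1)) :
    euler α x ∈ genSpan ι ^ n :=
  pderivSum_mem α _ (fun k _ h => neg_dz_pow_mem k n h) hx

/-- The boundary term of repeated integration by parts:
`∂_z^m f * x = f * (-∂_z)^m x + ∂_z (byParts m f x)`. -/
noncomputable def byParts : ℕ → JetPoly ι →ₗ[ℂ] JetPoly ι →ₗ[ℂ] JetPoly ι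
  | 0 => 0
  | m + 1 => (LinearMap.mul ℂ (JetPoly ι)).comp (dz ^ m) + (byParts m).compl₂ ((-1 : ℂ) • dz)

theorem byParts_succ (m : ℕ) (f x : JetPoly ι) :
    byParts (m + 1) f x =
      (dz ^ m : Module.End ℂ (JetPoly ι)) f * x + byParts m f ((-1 : ℂ) • dz x) := rfl

/-- Works in an additive monoid: signs are carried by the scalar `-1` instead of a negation. -/
theorem neg_one_smul_add_self {M : Type*} [AddCommMonoid M] [Module ℂ M] (x : M) :
    (-1 : ℂ) • x + x = 0 := by
  have h : (-1 : ℂ) • x + (1 : ℂ) • x = 0 := by rw [← add_smul]; simp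
  rwa [one_smul] at h

theorem neg_dz_apply (x : JetPoly ι) : (-dz : Module.End ℂ (JetPoly ι)) x = (-1 : ℂ) • dz x :=
  (neg_one_smul ℂ (dz x)).symm

theorem dz_pow_mul (m : ℕ) (f x : JetPoly ι) :
    (dz ^ m : Module.End ℂ (JetPoly ι)) f * x =
      f * ((-dz) ^ m : Module.End ℂ (JetPoly ι)) x + dz (byParts m f x) := by
  induction m generalizing x with
  | zero => simp [byParts]
  | succ m ih =>
    -- By Leibniz, `∂^{m+1} f · x = ∂(∂^m f · x) - ∂^m f · ∂x`; the hypothesis at `-∂x` treats the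
    -- last term.
    have h := ih ((-1 : ℂ) • dz x)
    rw [byParts_succ, map_add, dz_mul, pow_succ' dz, Module.End.mul_apply, pow_succ (-dz),
      Module.End.mul_apply, neg_dz_apply]
    rw [mul_smul_comm] at h
    have h2 := neg_one_smul_add_self ((dz ^ m : Module.End ℂ (JetPoly ι)) f * dz x)
    rw [h] at h2
    calc dz ((dz ^ m : Module.End ℂ (JetPoly ι)) f) * x
        = 0 + dz ((dz ^ m : Module.End ℂ (JetPoly ι)) f) * x := (zero_add _).symm
      _ = _ := by rw [← h2]; abel

theorem dz_pow_mem (k n : ℕ) {x : JetPoly ι} (hx : x ∈ genSpan ι ^ n) :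
    (dz ^ k : Module.End ℂ (JetPoly ι)) x ∈ genSpan ι ^ n := by
  induction k with
  | zero => simpa using hx
  | succ k ih =>
    rw [pow_succ', Module.End.mul_apply]
    exact dz_mem n ih

theorem byParts_mem (m : ℕ) {i j : ℕ} {f x : JetPoly ι} (hf : f ∈ genSpan ι ^ i)
    (hx : x ∈ genSpan ι ^ j) : byParts m f x ∈ genSpan ι ^ (i + j) := by
  induction m generalizing x with
  | zero => exact zero_mem _
  | succ m ih =>
    rw [byParts_succ]
    refine add_mem ?_ (ih (Submodule.smul_mem _ _ (dz_mem j hx)))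
    rw [pow_add]
    exact Submodule.mul_mem_mul (dz_pow_mem m i hf) hx

variable [Fintype ι] [DecidableEq ι] (g : Matrix ι ι ℂ)

/-- The variational bracket of polynomials. -/
noncomputable def bracket : JetPoly ι →ₗ[ℂ] JetPoly ι →ₗ[ℂ] JetPoly ι :=
  ∑ α, ∑ β, g⁻¹ α β • (LinearMap.mul ℂ (JetPoly ι)).compl₁₂ (euler α) (dz ∘ₗ euler β)

theorem bracket_apply (x y : JetPoly ι) :
    bracket g x y = ∑ α, ∑ β, g⁻¹ α β • (euler α x * dz (euler β y)) := by
  simp [bracket, LinearMap.sum_apply]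

/-- The direction `-∑_α g^{αβ} ∂_z E_α(x)` of the Hamiltonian vector field of `x`. -/
noncomputable def hamiltonian (x : JetPoly ι) (β : ι) : JetPoly ι :=
  (-1 : ℂ) • ∑ α, g⁻¹ α β • dz (euler α x)

/-- The term `∑_m byParts m f (∂y / ∂(∂_z^m λ^β_0))`. -/
noncomputable def boundary (β : ι) : JetPoly ι →ₗ[ℂ] JetPoly ι →ₗ[ℂ] JetPoly ι where
  toFun f := pderivSum β fun m => byParts m f
  map_add' f f' := by
    ext y
    obtain ⟨K, hK⟩ := exists_pderivSum_eq y
    simp [hK K le_rfl, Finset.sum_add_distrib]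
  map_smul' c f := by
    ext y
    obtain ⟨K, hK⟩ := exists_pderivSum_eq y
    simp [hK K le_rfl, Finset.smul_sum]

omit [Fintype ι] [DecidableEq ι] in
theorem boundary_mem (β : ι) {i j : ℕ} {f y : JetPoly ι} (hf : f ∈ genSpan ι ^ i)
    (hy : y ∈ genSpan ι ^ (j + 1)) : boundary β f y ∈ genSpan ι ^ (i + j) :=
  pderivSum_mem β _ (fun m _ h => byParts_mem m hf h) hy

-- Integration by parts in every order `m` at once: the derivative of `y` along `f` in the direction
-- `λ^β_0` is `f` times the Euler operator, up to an exact term.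
omit [Fintype ι] [DecidableEq ι] in
theorem pderivSum_mul (β : ι) (f y : JetPoly ι) :
    (pderivSum β fun m => LinearMap.mul ℂ (JetPoly ι) ((dz ^ m : Module.End ℂ (JetPoly ι)) f)) y =
      f * euler β y + dz (boundary β f y) := by
  obtain ⟨K, hK⟩ := exists_pderivSum_eq y
  simp [boundary, euler, hK K le_rfl, Finset.mul_sum, dz_pow_mul, Finset.sum_add_distrib]

/-- The potential of the exact term in the bracket of a local functional and a current. -/
noncomputable def potential : JetPoly ι →ₗ[ℂ] JetPoly ι →ₗ[ℂ] JetPoly ι :=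
  (-1 : ℂ) • ∑ α, ∑ β, g⁻¹ α β • ((LinearMap.mul ℂ (JetPoly ι)).compl₁₂ (euler α) (euler β) +
    (boundary β).comp (dz ∘ₗ euler α))

theorem potential_apply (x y : JetPoly ι) :
    potential g x y =
      (-1 : ℂ) • ∑ α, ∑ β, g⁻¹ α β • (euler α x * euler β y + boundary β (dz (euler α x)) y) := by
  simp only [potential, LinearMap.smul_apply, LinearMap.sum_apply, LinearMap.add_apply,
    LinearMap.compl₁₂_apply, LinearMap.comp_apply, LinearMap.mul_apply']

/-- The derivative of `y` along the Hamiltonian vector field of `x` is the bracket up to a total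
derivative. -/
theorem sum_pderivSum_hamiltonian (x y : JetPoly ι) :
    ∑ β, (pderivSum β fun m => LinearMap.mul ℂ (JetPoly ι)
      ((dz ^ m : Module.End ℂ (JetPoly ι)) (hamiltonian g x β))) y =
      bracket g x y + dz (potential g x y) := by
  -- The second integration by parts: `-∂E_α(x) · E_β(y) = E_α(x) · ∂E_β(y) - ∂(E_α(x) E_β(y))`. The
  -- factors keep their order, as the algebra is only supercommutative.
  have h : ∀ β, hamiltonian g x β * euler β y + dz (boundary β (hamiltonian g x β) y) =
      ∑ α, g⁻¹ α β • (euler α x * dz (euler β y)) + dz ((-1 : ℂ) • ∑ α, g⁻¹ α β •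
        (euler α x * euler β y + boundary β (dz (euler α x)) y)) := by
    intro β
    have h2 := neg_one_smul_add_self (∑ α, g⁻¹ α β • (euler α x * dz (euler β y)))
    simp only [hamiltonian, map_sum, map_smul, Finset.sum_mul, smul_mul_assoc,
      LinearMap.sum_apply, LinearMap.smul_apply, map_add, dz_mul, smul_add,
      Finset.sum_add_distrib] at h2 ⊢
    rw [← add_assoc, ← add_assoc, add_comm (∑ α, g⁻¹ α β • (euler α x * dz (euler β y))), h2,
      zero_add]
  simp only [pderivSum_mul, h, Finset.sum_add_distrib, ← map_sum, ← Finset.smul_sum]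
  rw [bracket_apply, potential_apply, Finset.sum_comm,
    Finset.sum_comm (γ := ι) (f := fun β α => g⁻¹ α β • (euler α x * euler β y +
      boundary β (dz (euler α x)) y))]

theorem bracket_mem {i j : ℕ} {x y : JetPoly ι} (hx : x ∈ genSpan ι ^ (i + 1))
    (hy : y ∈ genSpan ι ^ (j + 1)) : bracket g x y ∈ genSpan ι ^ (i + j) := by
  rw [bracket_apply]
  refine sum_mem fun α _ => sum_mem fun β _ => Submodule.smul_mem _ _ ?_
  rw [pow_add]
  exact Submodule.mul_mem_mul (euler_mem α hx) (dz_mem j (euler_mem β hy))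

theorem potential_mem {i j : ℕ} {x y : JetPoly ι} (hx : x ∈ genSpan ι ^ (i + 1))
    (hy : y ∈ genSpan ι ^ (j + 1)) : potential g x y ∈ genSpan ι ^ (i + j) := by
  rw [potential_apply]
  refine Submodule.smul_mem _ _
    (sum_mem fun α _ => sum_mem fun β _ => Submodule.smul_mem _ _ (add_mem ?_ ?_))
  · rw [pow_add]
    exact Submodule.mul_mem_mul (euler_mem α hx) (euler_mem β hy)
  · exact boundary_mem β (dz_mem i (euler_mem α hx)) hy

end JetPoly

/-! ### Power series and their truncations. -/

namespace JetSeries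

variable {ι : Type}

/-- The sum of the components of degree at most `N`. -/
noncomputable def trunc (N : ℕ) (L : JetSeries ι) : JetPoly ι :=
  ∑ n ∈ Finset.range (N + 1), L.coeff n

/-- The extension to series of a bilinear map that lowers each degree by `1`. -/
noncomputable def conv (b : JetPoly ι →ₗ[ℂ] JetPoly ι →ₗ[ℂ] JetPoly ι)
    (hb : ∀ {i j : ℕ} {x y : JetPoly ι}, x ∈ JetPoly.genSpan ι ^ (i + 1) →
      y ∈ JetPoly.genSpan ι ^ (j + 1) → b x y ∈ JetPoly.genSpan ι ^ (i + j))
    (L₁ L₂ : JetSeries ι) : JetSeries ι where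
  coeff n := ∑ ij ∈ Finset.HasAntidiagonal.antidiagonal n,
    b (L₁.coeff (ij.1 + 1)) (L₂.coeff (ij.2 + 1))
  homog n := sum_mem fun ij h => by
    rw [← Finset.HasAntidiagonal.mem_antidiagonal.mp h]
    exact hb (L₁.homog _) (L₂.homog _)

theorem ext_coeff {L L' : JetSeries ι} (h : ∀ n, L.coeff n = L'.coeff n) : L = L' := by
  cases L; cases L'
  congr
  exact funext h

/-- The Euler operator in degree `n` reads the component of degree `n + 1`, which is the index shift
in `conv`; what remains is an exchange of finite sums. -/
theorem bracket_eq_conv [Fintype ι] [DecidableEq ι] (g : Matrix ι ι ℂ) (L₁ L₂ : JetSeries ι) :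
    bracket g L₁ L₂ = conv (JetPoly.bracket g) (JetPoly.bracket_mem g) L₁ L₂ := by
  refine ext_coeff fun n => ?_
  simp only [conv, JetPoly.bracket_apply]
  rw [Finset.sum_comm]
  refine Finset.sum_congr rfl fun α _ => ?_
  rw [Finset.sum_comm]
  refine Finset.sum_congr rfl fun β _ => ?_
  rw [Finset.smul_sum]
  rfl

theorem coeff_zero_eq (L : JetSeries ι) : ∃ c : ℂ, L.coeff 0 = algebraMap ℂ _ c := by
  have h := L.homog 0
  rw [pow_zero] at h
  obtain ⟨c, hc⟩ := Submodule.mem_one.mp h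
  exact ⟨c, hc.symm⟩

end JetSeries

/-! ### Wirtinger derivatives of smooth functions. -/

section wirtinger

theorem wirtinger_add {f h : ℂ → ℂ} (hf : ContDiff ℝ ∞ f) (hh : ContDiff ℝ ∞ h) (z : ℂ) :
    wirtinger (fun w => f w + h w) z = wirtinger f z + wirtinger h z := by
  have h1 := (hf.differentiable (by simp)).differentiableAt (x := z)
  have h2 := (hh.differentiable (by simp)).differentiableAt (x := z)
  simp only [wirtinger, fderiv_fun_add h1 h2, add_apply]
  ring

theorem wirtinger_const_mul {f : ℂ → ℂ} (hf : ContDiff ℝ ∞ f) (c z : ℂ) :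
    wirtinger (fun w => c * f w) z = c * wirtinger f z := by
  have h1 := (hf.differentiable (by simp)).differentiableAt (x := z)
  simp only [wirtinger, fderiv_const_mul h1 c, smul_apply, smul_eq_mul]
  ring

theorem wirtinger_mul {f h : ℂ → ℂ} (hf : ContDiff ℝ ∞ f) (hh : ContDiff ℝ ∞ h) (z : ℂ) :
    wirtinger (fun w => f w * h w) z = f z * wirtinger h z + wirtinger f z * h z := by
  have h1 := (hf.differentiable (by simp)).differentiableAt (x := z)
  have h2 := (hh.differentiable (by simp)).differentiableAt (x := z)
  simp only [wirtinger, fderiv_fun_mul h1 h2, add_apply,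
    smul_apply, smul_eq_mul]
  ring

theorem wirtinger_sum {κ : Type*} (s : Finset κ) {f : κ → ℂ → ℂ}
    (hf : ∀ i, ContDiff ℝ ∞ (f i)) (z : ℂ) :
    wirtinger (fun w => ∑ i ∈ s, f i w) z = ∑ i ∈ s, wirtinger (f i) z := by
  classical
  induction s using Finset.induction_on with
  | empty => simp [wirtinger]
  | insert a s ha ih =>
    simp only [Finset.sum_insert ha]
    rw [wirtinger_add (hf a) (ContDiff.sum fun i _ => hf i), ih]

theorem wirtinger_const (c z : ℂ) : wirtinger (fun _ => c) z = 0 := by simp [wirtinger]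

theorem contDiff_fderiv_apply {f : ℂ → ℂ} (hf : ContDiff ℝ ∞ f) (v : ℂ) :
    ContDiff ℝ ∞ fun z => fderiv ℝ f z v :=
  (hf.fderiv_right (m := ∞) (by simp)).clm_apply contDiff_const

theorem contDiff_wirtinger {f : ℂ → ℂ} (hf : ContDiff ℝ ∞ f) : ContDiff ℝ ∞ (wirtinger f) :=
  ((contDiff_fderiv_apply hf 1).sub
    (contDiff_const.mul (contDiff_fderiv_apply hf Complex.I))).div_const 2

theorem wirtinger_add_one {f : ℂ → ℂ} (hf : ∀ z, f (z + 1) = f z) (z : ℂ) :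
    wirtinger f (z + 1) = wirtinger f z := by
  have h : fderiv ℝ f (z + 1) = fderiv ℝ f z := by
    rw [← fderiv_comp_add_right]
    simp only [hf]
  simp only [wirtinger, h]

theorem wirtinger_congr {f h : ℂ → ℂ} {z : ℂ} (hfh : f =ᶠ[nhds z] h) :
    wirtinger f z = wirtinger h z := by
  simp only [wirtinger, hfh.fderiv_eq]

theorem wirtinger_eq_zero_of_support {f : ℂ → ℂ} {M : ℝ} (hf : ∀ z : ℂ, M < |z.im| → f z = 0)
    {z : ℂ} (hz : M < |z.im|) : wirtinger f z = 0 := by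
  have : f =ᶠ[nhds z] fun _ => 0 := by
    have ho : IsOpen {w : ℂ | M < |w.im|} :=
      isOpen_lt continuous_const (continuous_abs.comp Complex.continuous_im)
    filter_upwards [ho.mem_nhds hz] with w hw using hf w hw
  rw [wirtinger_congr this, wirtinger_const]

/-- By the Cauchy–Riemann equation `f` is holomorphic on `U`; there `∂f` is the complex derivative
of `f`, which is again holomorphic. -/
theorem wirtingerBar_wirtinger {f : ℂ → ℂ} (hf : ContDiff ℝ ∞ f) {U : Set ℂ} (hU : IsOpen U)
    (h : ∀ z ∈ U, wirtingerBar f z = 0) {z : ℂ} (hz : z ∈ U) :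
    wirtingerBar (wirtinger f) z = 0 := by
  have hd : DifferentiableOn ℂ f U := fun w hw => by
    refine DifferentiableAt.differentiableWithinAt ?_
    rw [differentiableAt_complex_iff_differentiableAt_real]
    refine ⟨(hf.differentiable (by simp)).differentiableAt, ?_⟩
    have h1 := h w hw
    simp only [wirtingerBar, div_eq_zero_iff, OfNat.ofNat_ne_zero, or_false] at h1
    rw [smul_eq_mul]
    linear_combination (-Complex.I) * h1 + fderiv ℝ f w Complex.I * Complex.I_mul_I
  have he : wirtinger f =ᶠ[nhds z] deriv f := by
    filter_upwards [hU.mem_nhds hz] with w hw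
    have h2 : DifferentiableAt ℂ f w := hd.differentiableAt (hU.mem_nhds hw)
    simp only [wirtinger, h2.fderiv_restrictScalars ℝ, ContinuousLinearMap.coe_restrictScalars']
    have h3 : fderiv ℂ f w Complex.I = Complex.I * fderiv ℂ f w 1 := by
      rw [← smul_eq_mul, ← map_smul, smul_eq_mul, mul_one]
    rw [h3, ← mul_assoc, Complex.I_mul_I, fderiv_apply_one_eq_deriv]
    ring
  have h4 : DifferentiableAt ℂ (deriv f) z := (hd.deriv hU).differentiableAt (hU.mem_nhds hz)
  simp only [wirtingerBar, he.fderiv_eq]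
  rw [(differentiableAt_complex_iff_differentiableAt_real.mp h4).2, smul_eq_mul, ← mul_assoc,
    Complex.I_mul_I]
  ring

theorem wirtingerBar_mul {f h : ℂ → ℂ} (hf : ContDiff ℝ ∞ f) (hh : ContDiff ℝ ∞ h) (z : ℂ) :
    wirtingerBar (fun w => f w * h w) z = f z * wirtingerBar h z + wirtingerBar f z * h z := by
  have h1 := (hf.differentiable (by simp)).differentiableAt (x := z)
  have h2 := (hh.differentiable (by simp)).differentiableAt (x := z)
  simp only [wirtingerBar, fderiv_fun_mul h1 h2, add_apply,
    smul_apply, smul_eq_mul]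
  ring

theorem wirtingerBar_add {f h : ℂ → ℂ} (hf : ContDiff ℝ ∞ f) (hh : ContDiff ℝ ∞ h) (z : ℂ) :
    wirtingerBar (fun w => f w + h w) z = wirtingerBar f z + wirtingerBar h z := by
  have h1 := (hf.differentiable (by simp)).differentiableAt (x := z)
  have h2 := (hh.differentiable (by simp)).differentiableAt (x := z)
  simp only [wirtingerBar, fderiv_fun_add h1 h2, add_apply]
  ring

theorem wirtingerBar_sum {κ : Type*} (s : Finset κ) {f : κ → ℂ → ℂ}
    (hf : ∀ i, ContDiff ℝ ∞ (f i)) (z : ℂ) :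
    wirtingerBar (fun w => ∑ i ∈ s, f i w) z = ∑ i ∈ s, wirtingerBar (f i) z := by
  classical
  induction s using Finset.induction_on with
  | empty => simp [wirtingerBar]
  | insert a s ha ih =>
    simp only [Finset.sum_insert ha]
    rw [wirtingerBar_add (hf a) (ContDiff.sum fun i _ => hf i), ih]

theorem wirtingerBar_const_mul {f : ℂ → ℂ} (hf : ContDiff ℝ ∞ f) (c z : ℂ) :
    wirtingerBar (fun w => c * f w) z = c * wirtingerBar f z := by
  have h1 := (hf.differentiable (by simp)).differentiableAt (x := z)
  simp only [wirtingerBar, fderiv_const_mul h1 c, smul_apply, smul_eq_mul]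
  ring

end wirtinger

/-! ### Integration over the circle and the cylinder. -/

section integrals

theorem continuous_complex_mk : Continuous fun p : ℝ × ℝ => (⟨p.1, p.2⟩ : ℂ) :=
  Complex.equivRealProdCLM.symm.continuous

theorem hasDerivAt_comp_re {f : ℂ → ℂ} (hf : ContDiff ℝ ∞ f) (x y : ℝ) :
    HasDerivAt (fun t : ℝ => f ⟨t, y⟩) (fderiv ℝ f ⟨x, y⟩ 1) x := by
  have h1 : HasDerivAt (fun t : ℝ => (⟨t, y⟩ : ℂ)) 1 x := by
    have := (Complex.ofRealCLM.hasDerivAt (x := x)).add_const ((y : ℂ) * Complex.I)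
    simpa [Complex.mk_eq_add_mul_I] using this
  exact ((hf.differentiable (by simp)).differentiableAt.hasFDerivAt).comp_hasDerivAt x h1

theorem hasDerivAt_comp_im {f : ℂ → ℂ} (hf : ContDiff ℝ ∞ f) (x y : ℝ) :
    HasDerivAt (fun t : ℝ => f ⟨x, t⟩) (fderiv ℝ f ⟨x, y⟩ Complex.I) y := by
  have h1 : HasDerivAt (fun t : ℝ => (⟨x, t⟩ : ℂ)) Complex.I y := by
    have := ((Complex.ofRealCLM.hasDerivAt (x := y)).mul_const Complex.I).const_add (x : ℂ)
    simpa [Complex.mk_eq_add_mul_I] using this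
  exact ((hf.differentiable (by simp)).differentiableAt.hasFDerivAt).comp_hasDerivAt y h1

/-- Where `∂̄f = 0` one has `∂f = ∂_x f`, and the integral of `∂_x f` over a period is zero. -/
theorem integral_wirtinger_eq_zero {f : ℂ → ℂ} (hf : ContDiff ℝ ∞ f) (hp : ∀ z, f (z + 1) = f z)
    (h : ∀ x : ℝ, wirtingerBar f x = 0) : ∫ x in (0 : ℝ)..1, wirtinger f x = 0 := by
  have e : ∀ x : ℝ, wirtinger f x = fderiv ℝ f ⟨x, 0⟩ 1 := fun x => by
    have h1 := h x
    change wirtinger f x = fderiv ℝ f (x : ℂ) 1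
    simp only [wirtingerBar, wirtinger] at h1 ⊢
    linear_combination -h1
  simp only [e]
  rw [intervalIntegral.integral_eq_sub_of_hasDerivAt (fun x _ => hasDerivAt_comp_re hf x 0)]
  · have : (⟨1, 0⟩ : ℂ) = ⟨0, 0⟩ + 1 := by apply Complex.ext <;> simp
    rw [this, hp, sub_self]
  · refine Continuous.intervalIntegrable ?_ _ _
    exact (contDiff_fderiv_apply hf 1).continuous.comp
      (continuous_complex_mk.comp (continuous_id.prodMk continuous_const))

theorem integral_im_eq {f : ℂ → ℂ} {M : ℝ} (h : ∀ z : ℂ, M < |z.im| → f z = 0) (x : ℝ) :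
    ∫ y : ℝ, f ⟨x, y⟩ = ∫ y in (-(M + 1))..(M + 1), f ⟨x, y⟩ := by
  symm
  refine intervalIntegral.integral_eq_integral_of_support_subset fun y hy => ?_
  have : |y| ≤ M := by
    by_contra h1
    exact hy (h ⟨x, y⟩ (not_le.mp h1))
  obtain ⟨h1, h2⟩ := abs_le.mp this
  exact ⟨by linarith, by linarith⟩

/-- The Lebesgue integral over the cylinder. -/
noncomputable def cylInt (f : ℂ → ℂ) : ℂ := ∫ x in (0 : ℝ)..1, ∫ y : ℝ, f ⟨x, y⟩

theorem cylInt_eq {f : ℂ → ℂ} {M : ℝ} (h : ∀ z : ℂ, M < |z.im| → f z = 0) :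
    cylInt f = ∫ x in (0 : ℝ)..1, ∫ y in (-(M + 1))..(M + 1), f ⟨x, y⟩ := by
  simp only [cylInt, integral_im_eq h]

theorem continuous_integral_im {X : Type*} [TopologicalSpace X] {f : X → ℂ → ℂ}
    (hf : Continuous fun q : X × ℂ => f q.1 q.2) (a b : ℝ) :
    Continuous fun q : X × ℝ => ∫ y in a..b, f q.1 ⟨q.2, y⟩ := by
  refine intervalIntegral.continuous_parametric_intervalIntegral_of_continuous' ?_ a b
  exact hf.comp ((continuous_fst.comp continuous_fst).prodMk
    (continuous_complex_mk.comp ((continuous_snd.comp continuous_fst).prodMk continuous_snd)))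

theorem continuous_integral_re {X : Type*} [TopologicalSpace X]
    {f : X → ℝ → ℂ} (hf : Continuous fun q : X × ℝ => f q.1 q.2) (a b : ℝ) :
    Continuous fun s => ∫ x in a..b, f s x :=
  intervalIntegral.continuous_parametric_intervalIntegral_of_continuous' hf a b

theorem continuous_cylInt {f : ℝ → ℂ → ℂ} (hf : Continuous fun q : ℝ × ℂ => f q.1 q.2)
    {M : ℝ} (h : ∀ s, ∀ z : ℂ, M < |z.im| → f s z = 0) : Continuous fun s => cylInt (f s) := by
  simp only [fun s => cylInt_eq (h s)]
  exact continuous_integral_re (continuous_integral_im hf _ _) 0 1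

theorem continuous_integral_im' {f : ℂ → ℂ} (hf : Continuous f) (a b : ℝ) :
    Continuous fun x : ℝ => ∫ y in a..b, f ⟨x, y⟩ :=
  (continuous_integral_im (X := Unit) (f := fun _ => f) (hf.comp continuous_snd) a b).comp
    (Continuous.prodMk (continuous_const (y := ())) continuous_id)

theorem cylInt_add {f h : ℂ → ℂ} (hf : Continuous f) (hh : Continuous h)
    (sf : ∃ M : ℝ, ∀ z : ℂ, M < |z.im| → f z = 0) (sh : ∃ M : ℝ, ∀ z : ℂ, M < |z.im| → h z = 0) :
    cylInt (fun z => f z + h z) = cylInt f + cylInt h := by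
  obtain ⟨M, hM⟩ := sf
  obtain ⟨M', hM'⟩ := sh
  have h1 : ∀ z : ℂ, max M M' < |z.im| → f z = 0 := fun z hz => hM z (by
    exact (le_max_left _ _).trans_lt hz)
  have h2 : ∀ z : ℂ, max M M' < |z.im| → h z = 0 := fun z hz => hM' z (by
    exact (le_max_right _ _).trans_lt hz)
  have c : ∀ {k : ℂ → ℂ}, Continuous k → ∀ x : ℝ, Continuous fun y : ℝ => k ⟨x, y⟩ :=
    fun hk x => hk.comp (continuous_complex_mk.comp (continuous_const.prodMk continuous_id))
  rw [cylInt_eq h1, cylInt_eq h2, cylInt_eq (M := max M M') fun z hz => by rw [h1 z hz, h2 z hz,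
    add_zero], ← intervalIntegral.integral_add]
  · refine intervalIntegral.integral_congr fun x _ => ?_
    exact intervalIntegral.integral_add ((c hf x).intervalIntegrable _ _)
      ((c hh x).intervalIntegrable _ _)
  · exact (continuous_integral_im' hf _ _).intervalIntegrable _ _
  · exact (continuous_integral_im' hh _ _).intervalIntegrable _ _

theorem cylInt_const_mul (c : ℂ) (f : ℂ → ℂ) : cylInt (fun z => c * f z) = c * cylInt f := by
  simp [cylInt, MeasureTheory.integral_const_mul]

theorem cylInt_zero : cylInt (fun _ => 0) = 0 := by simp [cylInt]

theorem cylInt_sum {κ : Type*} (s : Finset κ) {f : κ → ℂ → ℂ} (hf : ∀ i, Continuous (f i))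
    (h : ∀ i, ∃ M : ℝ, ∀ z : ℂ, M < |z.im| → f i z = 0) :
    cylInt (fun z => ∑ i ∈ s, f i z) = ∑ i ∈ s, cylInt (f i) := by
  classical
  have hs : ∀ s : Finset κ, ∃ M : ℝ, ∀ z : ℂ, M < |z.im| → ∑ i ∈ s, f i z = 0 := by
    intro s
    choose M hM using h
    refine ⟨∑ i ∈ s, |M i|, fun z hz => Finset.sum_eq_zero fun i hi => hM i z ?_⟩
    exact ((le_abs_self _).trans
      (Finset.single_le_sum (f := fun i => |M i|) (fun j _ => abs_nonneg _) hi)).trans_lt hz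
  induction s using Finset.induction_on with
  | empty => simp [cylInt_zero]
  | insert a s ha ih =>
    simp only [Finset.sum_insert ha]
    rw [cylInt_add (hf a) (continuous_finsetSum _ fun i _ => hf i) (h a) (hs s), ih]

/-- Stokes on the cylinder: after exchanging the integrals the `∂_x` half vanishes by periodicity,
and the `∂_y` half vanishes by compact support. -/
theorem cylInt_wirtinger {f : ℂ → ℂ} (hf : ContDiff ℝ ∞ f) (hp : ∀ z, f (z + 1) = f z)
    (h : ∃ M : ℝ, ∀ z : ℂ, M < |z.im| → f z = 0) : cylInt (wirtinger f) = 0 := by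
  obtain ⟨M, hM⟩ := h
  -- Strictly beyond the support bound, so `f` vanishes at height `b` and `-b`.
  set b := M + 1 with hb
  have c1 := (contDiff_fderiv_apply hf 1).continuous
  have c2 := (contDiff_fderiv_apply hf Complex.I).continuous
  have cx : ∀ {k : ℂ → ℂ}, Continuous k → ∀ x : ℝ, Continuous fun y : ℝ => k ⟨x, y⟩ :=
    fun hk x => hk.comp (continuous_complex_mk.comp (continuous_const.prodMk continuous_id))
  have cy : ∀ {k : ℂ → ℂ}, Continuous k → ∀ y : ℝ, Continuous fun x : ℝ => k ⟨x, y⟩ :=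
    fun hk x => hk.comp (continuous_complex_mk.comp (continuous_id.prodMk continuous_const))
  have z1 : ∫ x in (0 : ℝ)..1, ∫ y in (-b)..b, fderiv ℝ f ⟨x, y⟩ 1 = 0 := by
    rw [MeasureTheory.intervalIntegral_intervalIntegral_swap]
    · refine intervalIntegral.integral_zero_ae ?_
      refine Filter.Eventually.of_forall fun y _ => ?_
      rw [intervalIntegral.integral_eq_sub_of_hasDerivAt (fun x _ => hasDerivAt_comp_re hf x y)
        ((cy c1 y).intervalIntegrable _ _)]
      have : (⟨1, y⟩ : ℂ) = ⟨0, y⟩ + 1 := by apply Complex.ext <;> simp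
      rw [this, hp, sub_self]
    · refine MeasureTheory.IntegrableOn.mono_set (t := Set.uIcc 0 1 ×ˢ Set.uIcc (-b) b) ?_
        (Set.prod_mono Set.uIoc_subset_uIcc Set.uIoc_subset_uIcc)
      exact (c1.comp continuous_complex_mk).continuousOn.integrableOn_compact
        (isCompact_uIcc.prod isCompact_uIcc)
  have z2 : ∀ x : ℝ, ∫ y in (-b)..b, fderiv ℝ f ⟨x, y⟩ Complex.I = 0 := by
    intro x
    rw [intervalIntegral.integral_eq_sub_of_hasDerivAt (fun y _ => hasDerivAt_comp_im hf x y)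
      ((cx c2 x).intervalIntegrable _ _)]
    have hlt : M < |b| := lt_of_lt_of_le (by rw [hb]; linarith) (le_abs_self b)
    rw [hM ⟨x, b⟩ hlt, hM ⟨x, -b⟩ (by simpa using hlt), sub_zero]
  rw [cylInt_eq (M := M) fun z hz => wirtinger_eq_zero_of_support hM hz]
  have e : ∀ x : ℝ, ∫ y in (-b)..b, wirtinger f ⟨x, y⟩ =
      (∫ y in (-b)..b, fderiv ℝ f ⟨x, y⟩ 1) / 2 := by
    intro x
    simp only [wirtinger]
    rw [intervalIntegral.integral_div, intervalIntegral.integral_sub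
      ((cx c1 x).intervalIntegrable _ _)
      (((cx c2 x).intervalIntegrable _ _).const_mul _), intervalIntegral.integral_const_mul, z2]
    simp
  simp only [← hb, e]
  rw [intervalIntegral.integral_div, z1, zero_div]

/-- The coefficient of `s²` need only be continuous, because the difference quotient is `A + s · c
s`. This replaces differentiation under the integral sign. -/
theorem hasDerivAt_add_sq_mul (C A : ℂ) {c : ℝ → ℂ} (hc : Continuous c) :
    HasDerivAt (fun s : ℝ => C + s * A + s ^ 2 * c s) A 0 := by
  rw [hasDerivAt_iff_tendsto_slope_zero]
  have h : Filter.Tendsto (fun s : ℝ => A + s * c s) (nhdsWithin 0 {0}ᶜ) (nhds A) := by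
    have : Continuous fun s : ℝ => A + s * c s := by fun_prop
    simpa using (this.tendsto 0).mono_left nhdsWithin_le_nhds
  refine h.congr' ?_
  filter_upwards [self_mem_nhdsWithin] with s hs
  have : (s : ℂ) ≠ 0 := by exact_mod_cast hs
  simp only [zero_add, Complex.real_smul, Complex.ofReal_inv, Complex.ofReal_zero]
  field_simp
  ring

/-- The fundamental lemma of the calculus of variations. Testing against a cutoff in `Im` times the
conjugate of `Y` gives a nonnegative continuous integrand, which must vanish identically. -/
theorem eq_zero_of_cylInt_mul {Y : ℂ → ℂ} (hY : ContDiff ℝ ∞ Y) (hp : ∀ z, Y (z + 1) = Y z)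
    (h : ∀ f : ℂ → ℂ, ContDiff ℝ ∞ f → (∀ z, f (z + 1) = f z) →
      (∃ M : ℝ, ∀ z : ℂ, M < |z.im| → f z = 0) → cylInt (fun z => f z * Y z) = 0) (z : ℂ) :
    Y z = 0 := by
  let χ : ContDiffBump (z.im : ℝ) := ⟨1, 2, one_pos, one_lt_two⟩
  let k : ℂ → ℝ := fun w => χ w.im * ‖Y w‖ ^ 2
  have hχ : ContDiff ℝ ∞ fun w : ℂ => (χ w.im : ℂ) :=
    Complex.ofRealCLM.contDiff.comp (χ.contDiff.comp Complex.imCLM.contDiff)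
  have hM : ∀ w : ℂ, |z.im| + 2 < |w.im| → χ w.im = 0 := by
    intro w hw
    refine χ.zero_of_le_dist ?_
    rw [Real.dist_eq]
    have := abs_sub_abs_le_abs_sub w.im z.im
    change 2 ≤ _
    linarith
  have h1 := h (fun w => (χ w.im : ℂ) * (starRingEnd ℂ) (Y w))
    (hχ.mul (Complex.conjCLE.contDiff.comp hY)) (fun w => by simp [hp])
    ⟨|z.im| + 2, fun w hw => by simp [hM w hw]⟩
  have e : (fun w => (χ w.im : ℂ) * (starRingEnd ℂ) (Y w) * Y w) = fun w => (k w : ℂ) := by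
    funext w
    simp only [k, mul_assoc, Complex.conj_mul']
    push_cast
    rfl
  rw [e, cylInt_eq (M := |z.im| + 2) fun w hw => by simp [k, hM w hw]] at h1
  set b := |z.im| + 2 + 1 with hb
  have hk : Continuous k := by
    have : Continuous fun w : ℂ => χ w.im := χ.continuous.comp Complex.continuous_im
    exact this.mul (hY.continuous.norm.pow 2)
  have hk0 : ∀ w, 0 ≤ k w := fun w => mul_nonneg χ.nonneg (by positivity)
  simp only [intervalIntegral.integral_ofReal] at h1
  have h2 : ∫ x in (0 : ℝ)..1, ∫ y in (-b)..b, k ⟨x, y⟩ = 0 := by exact_mod_cast h1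
  have hbpos : -b < b := by have := abs_nonneg z.im; rw [hb]; linarith
  have hG : Continuous fun x : ℝ => ∫ y in (-b)..b, k ⟨x, y⟩ :=
    intervalIntegral.continuous_parametric_intervalIntegral_of_continuous'
      (f := fun x y => k ⟨x, y⟩) (hk.comp continuous_complex_mk) _ _
  have key : ∀ {a b : ℝ} {u : ℝ → ℝ}, a < b → Continuous u → (∀ x, 0 ≤ u x) →
      ∫ x in a..b, u x = 0 → ∀ x ∈ Set.Icc a b, u x = 0 := by
    intro a b u hab hu h0 hi x hx
    by_contra hne
    have : 0 < ∫ x in a..b, u x := intervalIntegral.integral_pos hab hu.continuousOn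
      (fun x _ => h0 x) ⟨x, hx, lt_of_le_of_ne (h0 x) (Ne.symm hne)⟩
    exact this.ne' hi
  -- The integral covers `0 ≤ Re ≤ 1` only, so the point is first translated there by the integer
  -- part of its real part; periodicity carries the result back.
  have h3 := key one_pos hG
    (fun x => intervalIntegral.integral_nonneg hbpos.le fun y _ => hk0 _) h2 (Int.fract z.re)
    ⟨Int.fract_nonneg _, (Int.fract_lt_one _).le⟩
  have h4 := key hbpos (hk.comp (continuous_complex_mk.comp
    (continuous_const.prodMk continuous_id))) (fun y => hk0 _) h3 z.im
    ⟨by have := neg_abs_le z.im; rw [hb]; linarith, by have := le_abs_self z.im; rw [hb]; linarith⟩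
  have h5 : χ z.im = 1 := χ.one_of_mem_closedBall (Metric.mem_closedBall_self χ.rIn_pos.le)
  have h6 : Y ⟨Int.fract z.re, z.im⟩ = 0 := by
    simpa [k, h5] using h4
  have h7 : Function.Periodic Y 1 := hp
  have h8 := (h7.int_mul ⌊z.re⌋) ⟨Int.fract z.re, z.im⟩
  rw [h6] at h8
  rw [← h8]
  congr 1
  apply Complex.ext <;> simp

end integrals

/-! ### Calculus of forms with Grassmann coefficients. -/

namespace SForm

theorem dz_apply (F : SForm) (z : ℂ) (I : Finset (WithTop ℕ)) :
    (dz F z).coeff I = wirtinger (fun w => (F w).coeff I) z := rfl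

theorem sum_coeff {κ : Type*} (s : Finset κ) (F : κ → SForm) (z : ℂ) (I : Finset (WithTop ℕ)) :
    ((∑ i ∈ s, F i) z).coeff I = ∑ i ∈ s, (F i z).coeff I := by
  rw [Finset.sum_apply, Gr.sum_apply]

/-- The coefficient `I` at the point `z`. -/
noncomputable def coeffAt (z : ℂ) (I : Finset (WithTop ℕ)) : SForm →ₗ[ℂ] ℂ where
  toFun F := (F z).coeff I
  map_add' _ _ := rfl
  map_smul' _ _ := rfl

theorem IsSmooth.const (a : Gr (WithTop ℕ)) : IsSmooth fun _ => a :=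
  ⟨fun _ => contDiff_const, fun _ => rfl⟩

theorem IsSmooth.add {F K : SForm} (hF : F.IsSmooth) (hK : K.IsSmooth) : (F + K).IsSmooth :=
  ⟨fun I => (hF.contDiff I).add (hK.contDiff I), fun z => by
    rw [Pi.add_apply, Pi.add_apply, hF.periodic, hK.periodic]⟩

theorem IsSmooth.smul {F : SForm} (hF : F.IsSmooth) (c : ℂ) : (c • F).IsSmooth :=
  ⟨fun I => contDiff_const.mul (hF.contDiff I), fun z => by
    rw [Pi.smul_apply, Pi.smul_apply, hF.periodic]⟩

theorem IsSmooth.mul {F K : SForm} (hF : F.IsSmooth) (hK : K.IsSmooth) : (F * K).IsSmooth :=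
  ⟨fun I => ContDiff.sum fun J _ =>
    contDiff_const.mul ((hF.contDiff J).mul (hK.contDiff (I \ J))), fun z => by
    rw [Pi.mul_apply, Pi.mul_apply, hF.periodic, hK.periodic]⟩

theorem IsSmooth.sum {κ : Type*} (s : Finset κ) {F : κ → SForm} (hF : ∀ i, (F i).IsSmooth) :
    (∑ i ∈ s, F i).IsSmooth :=
  Finset.sum_induction _ IsSmooth (fun _ _ => IsSmooth.add) (IsSmooth.const 0) fun i _ => hF i

theorem IsSmooth.dz {F : SForm} (hF : F.IsSmooth) : (dz F).IsSmooth :=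
  ⟨fun I => contDiff_wirtinger (hF.contDiff I), fun z => by
    ext I
    exact wirtinger_add_one (fun w => by rw [hF.periodic]) z⟩

theorem IsSmooth.dz_iterate {F : SForm} (hF : F.IsSmooth) (m : ℕ) : (SForm.dz^[m] F).IsSmooth := by
  induction m with
  | zero => exact hF
  | succ m ih => rw [Function.iterate_succ_apply']; exact ih.dz

theorem dz_add {F K : SForm} (hF : F.IsSmooth) (hK : K.IsSmooth) : dz (F + K) = dz F + dz K := by
  funext z
  ext I
  exact wirtinger_add (hF.contDiff I) (hK.contDiff I) z

theorem dz_smul {F : SForm} (hF : F.IsSmooth) (c : ℂ) : dz (c • F) = c • dz F := by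
  funext z
  ext I
  exact wirtinger_const_mul (hF.contDiff I) c z

theorem dz_const (a : Gr (WithTop ℕ)) : dz (fun _ => a) = 0 := by
  funext z
  ext I
  exact wirtinger_const _ z

theorem dz_sum {κ : Type*} (s : Finset κ) {F : κ → SForm} (hF : ∀ i, (F i).IsSmooth) :
    dz (∑ i ∈ s, F i) = ∑ i ∈ s, dz (F i) := by
  funext z
  ext I
  rw [dz_apply, sum_coeff]
  simp only [sum_coeff]
  exact wirtinger_sum s (fun i => (hF i).contDiff I) z

theorem dz_mul {F K : SForm} (hF : F.IsSmooth) (hK : K.IsSmooth) :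
    dz (F * K) = F * dz K + dz F * K := by
  funext z
  ext I
  rw [Pi.add_apply, Gr.add_apply, Pi.mul_apply, Pi.mul_apply, Gr.mul_apply, Gr.mul_apply, dz_apply]
  simp only [Pi.mul_apply, Gr.mul_apply]
  rw [wirtinger_sum _ fun J => contDiff_const.mul ((hF.contDiff J).mul (hK.contDiff (I \ J))),
    ← Finset.sum_add_distrib]
  refine Finset.sum_congr rfl fun J _ => ?_
  rw [wirtinger_const_mul ((hF.contDiff J).mul (hK.contDiff (I \ J))),
    wirtinger_mul (hF.contDiff J) (hK.contDiff (I \ J)), dz_apply, dz_apply]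
  ring

theorem dz_iterate_add {F K : SForm} (hF : F.IsSmooth) (hK : K.IsSmooth) (m : ℕ) :
    dz^[m] (F + K) = dz^[m] F + dz^[m] K := by
  induction m with
  | zero => rfl
  | succ m ih =>
    simp only [Function.iterate_succ_apply']
    rw [ih, dz_add (hF.dz_iterate m) (hK.dz_iterate m)]

theorem dz_iterate_smul {F : SForm} (hF : F.IsSmooth) (c : ℂ) (m : ℕ) :
    dz^[m] (c • F) = c • dz^[m] F := by
  induction m with
  | zero => rfl
  | succ m ih =>
    simp only [Function.iterate_succ_apply']
    rw [ih, dz_smul (hF.dz_iterate m)]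

theorem dz_iterate_const_mul {F : SForm} (hF : F.IsSmooth) (a : Gr (WithTop ℕ)) (m : ℕ) :
    dz^[m] (fun z => a * F z) = (fun _ => a) * dz^[m] F := by
  induction m with
  | zero => rfl
  | succ m ih =>
    simp only [Function.iterate_succ_apply']
    rw [ih, dz_mul (IsSmooth.const a) (hF.dz_iterate m), dz_const, zero_mul, add_zero]

/-- As `∂_z` acts on each coefficient separately, agreement of one coefficient at all points
survives differentiation. This passes identities valid only after truncation through `∂_z`. -/
theorem dz_iterate_coeff_congr {F K : SForm} {I : Finset (WithTop ℕ)}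
    (h : ∀ z, (F z).coeff I = (K z).coeff I) (m : ℕ) (z : ℂ) :
    (dz^[m] F z).coeff I = (dz^[m] K z).coeff I := by
  induction m generalizing z with
  | zero => exact h z
  | succ m ih =>
    simp only [Function.iterate_succ_apply', dz_apply]
    rw [funext ih]

theorem IsCompactlySupported.add {F K : SForm} (hF : F.IsCompactlySupported)
    (hK : K.IsCompactlySupported) : (F + K).IsCompactlySupported := fun I => by
  obtain ⟨M, hM⟩ := hF I
  obtain ⟨M', hM'⟩ := hK I
  refine ⟨max M M', fun z hz => ?_⟩
  rw [Pi.add_apply, Gr.add_apply, hM z ((le_max_left _ _).trans_lt hz),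
    hM' z ((le_max_right _ _).trans_lt hz), add_zero]

theorem IsCompactlySupported.zero : IsCompactlySupported 0 := fun _ => ⟨0, fun _ _ => rfl⟩

theorem IsCompactlySupported.smul {F : SForm} (hF : F.IsCompactlySupported) (c : ℂ) :
    (c • F).IsCompactlySupported := fun I => by
  obtain ⟨M, hM⟩ := hF I
  exact ⟨M, fun z hz => by rw [Pi.smul_apply, Gr.smul_apply, hM z hz, mul_zero]⟩

theorem IsCompactlySupported.sum {κ : Type*} (s : Finset κ) {F : κ → SForm}
    (hF : ∀ i, (F i).IsCompactlySupported) : (∑ i ∈ s, F i).IsCompactlySupported :=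
  Finset.sum_induction _ IsCompactlySupported (fun _ _ => IsCompactlySupported.add)
    IsCompactlySupported.zero fun i _ => hF i

/-- Support bounds may vary with the coefficient without a common bound; a product at `I` involves
only the finitely many subsets of `I`. -/
theorem exists_bound {F : SForm} (hF : F.IsCompactlySupported) (I : Finset (WithTop ℕ)) :
    ∃ M : ℝ, ∀ J ⊆ I, ∀ z : ℂ, M < |z.im| → (F z).coeff J = 0 := by
  choose M hM using hF
  refine ⟨∑ J ∈ I.powerset, |M J|, fun J hJ z hz => hM J z ?_⟩
  exact ((le_abs_self _).trans (Finset.single_le_sum (f := fun J => |M J|)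
    (fun _ _ => abs_nonneg _) (Finset.mem_powerset.mpr hJ))).trans_lt hz

theorem IsCompactlySupported.mul_right {F : SForm} (hF : F.IsCompactlySupported) (K : SForm) :
    (F * K).IsCompactlySupported := fun I => by
  obtain ⟨M, hM⟩ := exists_bound hF I
  refine ⟨M, fun z hz => Finset.sum_eq_zero fun J hJ => ?_⟩
  rw [hM J (Finset.mem_powerset.mp hJ) z hz, zero_mul, mul_zero]

theorem IsCompactlySupported.mul_left {F : SForm} (hF : F.IsCompactlySupported) (K : SForm) :
    (K * F).IsCompactlySupported := fun I => by
  obtain ⟨M, hM⟩ := exists_bound hF I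
  refine ⟨M, fun z hz => Finset.sum_eq_zero fun J _ => ?_⟩
  rw [hM (I \ J) Finset.sdiff_subset z hz, mul_zero, mul_zero]

theorem IsCompactlySupported.dz {F : SForm} (hF : F.IsCompactlySupported) :
    (dz F).IsCompactlySupported := fun I => by
  obtain ⟨M, hM⟩ := hF I
  exact ⟨M, fun z hz => wirtinger_eq_zero_of_support hM hz⟩

theorem IsCompactlySupported.dz_iterate {F : SForm} (hF : F.IsCompactlySupported) (m : ℕ) :
    (SForm.dz^[m] F).IsCompactlySupported := by
  induction m with
  | zero => exact hF
  | succ m ih => rw [Function.iterate_succ_apply']; exact ih.dz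

/-- Repeated integration by parts on forms. -/
theorem exists_dz_iterate_mul_eq {F : SForm} (hF : F.IsSmooth) (hc : F.IsCompactlySupported)
    (m : ℕ) {K : ℕ → SForm} (hK : ∀ i, (K i).IsSmooth)
    (hK' : ∀ i, K (i + 1) = (-1 : ℂ) • dz (K i)) :
    ∃ B : SForm, B.IsSmooth ∧ B.IsCompactlySupported ∧ dz^[m] F * K 0 = F * K m + dz B := by
  induction m generalizing K with
  | zero => exact ⟨0, IsSmooth.const 0, IsCompactlySupported.zero, by
      rw [show (0 : SForm) = fun _ => 0 from rfl, dz_const]; simp⟩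
  | succ m ih =>
    obtain ⟨B, hB, hBc, h⟩ := ih (K := fun i => K (i + 1)) (fun i => hK _) (fun i => hK' _)
    -- One step contributes the boundary term `∂^m F · K_0`; the remaining `m` steps are the
    -- hypothesis for the shifted sequence `K_{i+1}`.
    refine ⟨dz^[m] F * K 0 + B, ((hF.dz_iterate m).mul (hK 0)).add hB,
      ((hc.dz_iterate m).mul_right _).add hBc, ?_⟩
    rw [dz_add ((hF.dz_iterate m).mul (hK 0)) hB, dz_mul (hF.dz_iterate m) (hK 0),
      Function.iterate_succ_apply']
    simp only [zero_add, hK' 0, neg_smul, one_smul, mul_neg] at h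
    rw [show dz B = -(dz^[m] F * dz (K 0)) - F * K (m + 1) by rw [h]; abel]
    abel

end SForm

/-! ### Evaluation of polynomials and series on fields. -/

namespace FieldPoint

variable {ι : Type}

theorem eval_gen (φ : FieldPoint ι) (v : JetVar ι) : φ.eval (JetPoly.gen v) = φ.evalVar v :=
  JetPoly.lift_gen _ _ _ _

theorem evalVar_smooth (φ : FieldPoint ι) (v : JetVar ι) : (φ.evalVar v).IsSmooth := by
  cases v with
  | lam α k m => exact (φ.lam_smooth α k).dz_iterate m
  | rho α k m => exact (φ.rho_smooth α k).dz_iterate m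

theorem eval_algebraMap (φ : FieldPoint ι) (c : ℂ) :
    φ.eval (algebraMap ℂ _ c) = fun _ => algebraMap ℂ (Gr (WithTop ℕ)) c := AlgHom.commutes _ _

theorem eval_smooth (φ : FieldPoint ι) (x : JetPoly ι) : (φ.eval x).IsSmooth := by
  induction x using JetPoly.induction with
  | algebraMap c => rw [eval_algebraMap]; exact SForm.IsSmooth.const _
  | gen v => rw [eval_gen]; exact φ.evalVar_smooth v
  | mul x y hx hy => rw [map_mul]; exact hx.mul hy
  | add x y hx hy => rw [map_add]; exact hx.add hy

/-- The bridge between formal and analytic differentiation: both sides obey the Leibniz rule along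
`φ.eval` and agree on generators. -/
theorem eval_dz (φ : FieldPoint ι) (x : JetPoly ι) : φ.eval (JetPoly.dz x) = (φ.eval x).dz := by
  induction x using JetPoly.induction with
  | algebraMap c => rw [JetPoly.dz_algebraMap, map_zero, eval_algebraMap, SForm.dz_const]
  | gen v =>
    cases v with
    | lam α k m =>
      rw [JetPoly.dz_lam, eval_gen, eval_gen]
      exact Function.iterate_succ_apply' _ _ _
    | rho α k m =>
      rw [JetPoly.dz_rho, eval_gen, eval_gen]
      exact Function.iterate_succ_apply' _ _ _
  | mul x y hx hy =>
    rw [JetPoly.dz_mul, map_add, map_mul, map_mul, map_mul, hx, hy,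
      SForm.dz_mul (φ.eval_smooth x) (φ.eval_smooth y)]
  | add x y hx hy =>
    rw [map_add, map_add, map_add, hx, hy, SForm.dz_add (φ.eval_smooth x) (φ.eval_smooth y)]

theorem eval_dz_pow (φ : FieldPoint ι) (m : ℕ) (x : JetPoly ι) :
    φ.eval ((JetPoly.dz ^ m : Module.End ℂ (JetPoly ι)) x) = SForm.dz^[m] (φ.eval x) := by
  induction m with
  | zero => rfl
  | succ m ih => rw [pow_succ', Module.End.mul_apply, eval_dz, ih, Function.iterate_succ_apply']

theorem evalVar_vanishesBelow (φ : FieldPoint ι) (v : JetVar ι) (z : ℂ) :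
    (φ.evalVar v z).VanishesBelow 1 := by
  intro I hI
  obtain rfl : I = ∅ := Finset.card_eq_zero.mp (by omega)
  have h : ∀ {F : SForm}, F.IsInfinitesimal → ∀ m, (SForm.dz^[m] F z).coeff ∅ = 0 := by
    intro F hF m
    rw [SForm.dz_iterate_coeff_congr (K := 0) (fun z => (hF z).1)]
    have := SForm.dz_iterate_smul (F := 0) (SForm.IsSmooth.const 0) 0 m
    rw [smul_zero, zero_smul] at this
    rw [this]
    rfl
  cases v with
  | lam α k m => exact h (φ.lam_inf α k) m
  | rho α k m => exact h (φ.rho_inf α k) m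

/-- Infinitesimal values have no constant coefficient, so a product of `n` of them starts in
Grassmann degree `n`. -/
theorem eval_vanishesBelow (φ : FieldPoint ι) {n : ℕ} {x : JetPoly ι}
    (hx : x ∈ JetPoly.genSpan ι ^ n) (z : ℂ) : (φ.eval x z).VanishesBelow n := by
  induction n generalizing x with
  | zero => intro I hI; omega
  | succ n ih =>
    rw [pow_succ'] at hx
    refine Submodule.mul_induction_on hx ?_ ?_
    · intro a ha b hb
      rw [map_mul, add_comm]
      refine Gr.VanishesBelow.mul ?_ (ih hb)
      refine Submodule.span_induction (p := fun a _ => (φ.eval a z).VanishesBelow 1)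
        ?_ ?_ ?_ ?_ ha
      · rintro _ ⟨v, rfl⟩
        rw [eval_gen]
        exact φ.evalVar_vanishesBelow v z
      · intro I _; rw [map_zero]; rfl
      · intro a b _ _ ha hb I hI
        rw [map_add, Pi.add_apply, Gr.add_apply, ha I hI, hb I hI, add_zero]
      · intro c a _ ha I hI
        rw [map_smul, Pi.smul_apply, Gr.smul_apply, ha I hI, mul_zero]
    · intro a b ha hb I hI
      rw [map_add, Pi.add_apply, Gr.add_apply, ha I hI, hb I hI, add_zero]

end FieldPoint

namespace JetSeries

variable {ι : Type}

theorem apply_trunc {M : Type*} [AddCommMonoid M] [Module ℂ M] (ℓ : JetPoly ι →ₗ[ℂ] M)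
    (L : JetSeries ι) {n N : ℕ} (h : ∀ i, n < i → ℓ (L.coeff i) = 0) (hN : n ≤ N) :
    ℓ (L.trunc N) = ∑ i ∈ Finset.range (n + 1), ℓ (L.coeff i) := by
  rw [trunc, map_sum]
  symm
  refine Finset.sum_subset (Finset.range_mono (by omega)) fun i _ hi => h i ?_
  simp only [Finset.mem_range] at hi
  omega

theorem apply_trunc_eq {M : Type*} [AddCommMonoid M] [Module ℂ M] (ℓ : JetPoly ι →ₗ[ℂ] M)
    (L : JetSeries ι) {n N N' : ℕ} (h : ∀ i, n < i → ℓ (L.coeff i) = 0) (hN : n ≤ N)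
    (hN' : n ≤ N') : ℓ (L.trunc N) = ℓ (L.trunc N') := by
  rw [apply_trunc ℓ L h hN, apply_trunc ℓ L h hN']

end JetSeries

namespace FieldPoint

variable {ι : Type} (φ : FieldPoint ι)

/-- Components of degree above `I.card` cannot reach the coefficient `I`. Leaving `N` free lets all
subsets of `I` share one truncation. -/
theorem evalSeries_coeff (L : JetSeries ι) {I : Finset (WithTop ℕ)} {N : ℕ} (hN : I.card ≤ N)
    (z : ℂ) : (φ.evalSeries L z).coeff I = (φ.eval (L.trunc N) z).coeff I := by
  have h : ∀ i, I.card < i → (SForm.coeffAt z I ∘ₗ φ.eval.toLinearMap) (L.coeff i) = 0 :=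
    fun i hi => φ.eval_vanishesBelow (L.homog i) z I hi
  have h2 := JetSeries.apply_trunc _ L h hN
  refine Eq.trans ?_ h2.symm
  refine finsum_eq_sum_of_support_subset _ fun n hn => ?_
  simp only [Finset.coe_range, Set.mem_Iio]
  by_contra hlt
  exact hn (h n (by omega))

theorem evalSeries_smooth (L : JetSeries ι) : (φ.evalSeries L).IsSmooth := by
  refine ⟨fun I => ?_, fun z => ?_⟩
  · simp only [φ.evalSeries_coeff L (I := _) le_rfl]
    exact (φ.eval_smooth _).contDiff I
  · ext I
    rw [φ.evalSeries_coeff L le_rfl, φ.evalSeries_coeff L le_rfl, (φ.eval_smooth _).periodic]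

theorem dz_trunc (L : JetSeries ι) (N : ℕ) : L.dz.trunc N = JetPoly.dz (L.trunc N) := by
  rw [JetSeries.trunc, JetSeries.trunc, map_sum]
  rfl

theorem evalSeries_dz (L : JetSeries ι) : φ.evalSeries L.dz = (φ.evalSeries L).dz := by
  funext z
  ext I
  rw [φ.evalSeries_coeff _ le_rfl, dz_trunc, eval_dz]
  exact SForm.dz_iterate_coeff_congr (fun z => (φ.evalSeries_coeff L le_rfl z).symm) 1 z

/-- Convolution of series is computed on truncations. -/
theorem eval_trunc_conv (b : JetPoly ι →ₗ[ℂ] JetPoly ι →ₗ[ℂ] JetPoly ι) (hb)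
    (h1 : ∀ c x, b (algebraMap ℂ _ c) x = 0) (h2 : ∀ c x, b x (algebraMap ℂ _ c) = 0)
    (L₁ L₂ : JetSeries ι) {I : Finset (WithTop ℕ)} {N : ℕ} (hN : I.card ≤ N) (z : ℂ) :
    (φ.eval ((JetSeries.conv b hb L₁ L₂).trunc N) z).coeff I =
      (φ.eval (b (L₁.trunc (N + 1)) (L₂.trunc (N + 1))) z).coeff I := by
  set ℓ : JetPoly ι →ₗ[ℂ] ℂ := SForm.coeffAt z I ∘ₗ φ.eval.toLinearMap with hℓ
  change ℓ _ = ℓ _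
  -- Constant terms are killed by `h1` and `h2`, and `b` lowers both degrees by one; hence
  -- truncation at `N + 1` and the shifted indices.
  have e : b (L₁.trunc (N + 1)) (L₂.trunc (N + 1)) = ∑ i ∈ Finset.range (N + 1),
      ∑ j ∈ Finset.range (N + 1), b (L₁.coeff (i + 1)) (L₂.coeff (j + 1)) := by
    obtain ⟨c, hc⟩ := L₁.coeff_zero_eq
    obtain ⟨c', hc'⟩ := L₂.coeff_zero_eq
    rw [JetSeries.trunc, JetSeries.trunc, Finset.sum_range_succ', Finset.sum_range_succ' L₂.coeff,
      hc, hc']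
    simp [h1, h2, LinearMap.sum_apply]
  rw [e, JetSeries.trunc, map_sum, ← Finset.sum_product', map_sum]
  have e2 : ∀ n ∈ Finset.range (N + 1), ℓ ((JetSeries.conv b hb L₁ L₂).coeff n) =
      ∑ ij ∈ (Finset.range (N + 1) ×ˢ Finset.range (N + 1)) with ij.1 + ij.2 = n,
        ℓ (b (L₁.coeff (ij.1 + 1)) (L₂.coeff (ij.2 + 1))) := by
    intro n hn
    rw [JetSeries.conv, map_sum]
    refine Finset.sum_congr ?_ fun _ _ => rfl
    ext ij
    simp only [Finset.mem_range, Finset.HasAntidiagonal.mem_antidiagonal, Finset.mem_filter,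
      Finset.mem_product] at hn ⊢
    omega
  rw [Finset.sum_congr rfl e2]
  symm
  -- The square of index pairs exceeds the triangle `i + j ≤ N`; a pair outside it gives a value of
  -- degree above `I.card`, invisible at `I`.
  rw [← Finset.sum_filter_add_sum_filter_not _ fun ij : ℕ × ℕ => ij.1 + ij.2 ∈ Finset.range (N + 1)]
  rw [Finset.sum_eq_zero (s := Finset.filter (fun ij : ℕ × ℕ => ¬ _) _), add_zero]
  · rw [← Finset.sum_fiberwise_of_maps_to (t := Finset.range (N + 1))
      (g := fun ij : ℕ × ℕ => ij.1 + ij.2)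
      fun ij h => (Finset.mem_filter.mp h).2]
    refine Finset.sum_congr rfl fun n hn => Finset.sum_congr ?_ fun _ _ => rfl
    ext ij
    simp only [Finset.mem_filter]
    constructor
    · rintro ⟨⟨h, -⟩, h'⟩; exact ⟨h, h'⟩
    · rintro ⟨h, h'⟩; exact ⟨⟨h, h' ▸ hn⟩, h'⟩
  · intro ij h
    have h3 := (Finset.mem_filter.mp h).2
    simp only [Finset.mem_range] at h3
    exact φ.eval_vanishesBelow (hb (L₁.homog _) (L₂.homog _)) z I (by omega)

end FieldPoint

/-! ### Linearization along the directions `λ_0`. -/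

namespace FieldPoint

variable {ι : Type}

section linearization

variable [Fintype ι] (φ : FieldPoint ι)

/-- The derivative of a polynomial at `φ` in the direction `u` of the `λ_0`'s. -/
noncomputable def lin (u : ι → SForm) : JetPoly ι →ₗ[ℂ] SForm :=
  ∑ β, JetPoly.pderivSum β fun m =>
    LinearMap.mulLeft ℂ (SForm.dz^[m] (u β)) ∘ₗ φ.eval.toLinearMap

theorem exists_lin_eq (x : JetPoly ι) : ∃ K, ∀ N, K ≤ N → ∀ (φ : FieldPoint ι) (u : ι → SForm),
    φ.lin u x = ∑ β, ∑ m ∈ Finset.range N, SForm.dz^[m] (u β) * φ.eval (JetPoly.pderiv β m x) := by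
  obtain ⟨K, hK⟩ := JetPoly.exists_pderivSum_eq x
  refine ⟨K, fun N hN φ u => ?_⟩
  rw [lin, LinearMap.sum_apply]
  refine Finset.sum_congr rfl fun β _ => ?_
  rw [hK N hN]
  rfl

theorem lin_vanishesBelow (u : ι → SForm) {n : ℕ} {x : JetPoly ι}
    (hx : x ∈ JetPoly.genSpan ι ^ (n + 1)) (z : ℂ) : (φ.lin u x z).VanishesBelow n := by
  obtain ⟨K, hK⟩ := exists_lin_eq x
  intro I hI
  rw [hK K le_rfl φ u, SForm.sum_coeff]
  refine Finset.sum_eq_zero fun β _ => ?_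
  rw [SForm.sum_coeff]
  refine Finset.sum_eq_zero fun m _ => ?_
  have h0 : (SForm.dz^[m] (u β) z).VanishesBelow 0 := fun I hI => by omega
  have := h0.mul (φ.eval_vanishesBelow (JetPoly.pderiv_mem β m n hx) z)
  rw [zero_add] at this
  exact this I hI

theorem lin_smooth {u : ι → SForm} (hu : ∀ α, (u α).IsSmooth) (x : JetPoly ι) :
    (φ.lin u x).IsSmooth := by
  obtain ⟨K, hK⟩ := exists_lin_eq x
  rw [hK K le_rfl φ u]
  exact SForm.IsSmooth.sum _ fun β => SForm.IsSmooth.sum _ fun m =>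
    ((hu β).dz_iterate m).mul (φ.eval_smooth _)

theorem lin_compact {u : ι → SForm} (hu : ∀ α, (u α).IsCompactlySupported) (x : JetPoly ι) :
    (φ.lin u x).IsCompactlySupported := by
  obtain ⟨K, hK⟩ := exists_lin_eq x
  rw [hK K le_rfl φ u]
  exact SForm.IsCompactlySupported.sum _ fun β => SForm.IsCompactlySupported.sum _ fun m =>
    ((hu β).dz_iterate m).mul_right _

theorem lin_add {u v : ι → SForm} (hu : ∀ α, (u α).IsSmooth) (hv : ∀ α, (v α).IsSmooth)
    (x : JetPoly ι) : φ.lin (u + v) x = φ.lin u x + φ.lin v x := by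
  obtain ⟨K, hK⟩ := exists_lin_eq x
  simp only [hK K le_rfl φ, Pi.add_apply, SForm.dz_iterate_add (hu _) (hv _), add_mul,
    Finset.sum_add_distrib]

/-- The direction is the left factor in `lin`, so a constant, even or odd, comes out on the left
without a sign. -/
theorem lin_const_mul (a : Gr (WithTop ℕ)) {u : ι → SForm} (hu : ∀ α, (u α).IsSmooth)
    (x : JetPoly ι) : φ.lin (fun α z => a * u α z) x = (fun _ => a) * φ.lin u x := by
  obtain ⟨K, hK⟩ := exists_lin_eq x
  simp only [hK K le_rfl φ, SForm.dz_iterate_const_mul (hu _), mul_assoc, Finset.mul_sum]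

theorem lin_coeff_congr {u v : ι → SForm} {I : Finset (WithTop ℕ)}
    (h : ∀ α, ∀ J ⊆ I, ∀ z, (u α z).coeff J = (v α z).coeff J) (x : JetPoly ι) (z : ℂ) :
    (φ.lin u x z).coeff I = (φ.lin v x z).coeff I := by
  obtain ⟨K, hK⟩ := exists_lin_eq x
  rw [hK K le_rfl φ, hK K le_rfl φ, SForm.sum_coeff, SForm.sum_coeff]
  refine Finset.sum_congr rfl fun β _ => ?_
  rw [SForm.sum_coeff, SForm.sum_coeff]
  refine Finset.sum_congr rfl fun m _ => ?_
  exact Gr.mul_coeff_congr (fun J hJ => SForm.dz_iterate_coeff_congr (h β J hJ) m z)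
    fun J _ => rfl

/-- For a direction given by polynomials the derivative is itself the value of a polynomial, because
evaluation is multiplicative and commutes with `∂_z`. This hands the problem over to the formal
calculus. -/
theorem lin_eval (y : ι → JetPoly ι) (x : JetPoly ι) :
    φ.lin (fun β => φ.eval (y β)) x = φ.eval (∑ β, (JetPoly.pderivSum β fun m =>
      LinearMap.mul ℂ (JetPoly ι) ((JetPoly.dz ^ m : Module.End ℂ (JetPoly ι)) (y β))) x) := by
  obtain ⟨K, hK⟩ := exists_lin_eq x
  obtain ⟨K', hK'⟩ := JetPoly.exists_pderivSum_eq x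
  rw [hK (max K K') (le_max_left _ _), map_sum]
  refine Finset.sum_congr rfl fun β _ => ?_
  rw [hK' (max K K') (le_max_right _ _), map_sum]
  refine Finset.sum_congr rfl fun m _ => ?_
  rw [LinearMap.mul_apply', map_mul, eval_dz_pow]

theorem lin_algebraMap (u : ι → SForm) (c : ℂ) : φ.lin u (algebraMap ℂ _ c) = 0 := by
  rw [lin, LinearMap.sum_apply]
  exact Finset.sum_eq_zero fun β _ => JetPoly.pderivSum_algebraMap _ _ _

theorem lin_lam_zero (u : ι → SForm) (α : ι) (n : ℕ) :
    φ.lin u (JetPoly.gen (.lam α 0 n)) = SForm.dz^[n] (u α) := by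
  classical
  obtain ⟨K, hK⟩ := exists_lin_eq (JetPoly.gen (.lam α 0 n))
  rw [hK (K + n + 1) (by omega), Finset.sum_eq_single α, Finset.sum_eq_single n]
  · rw [JetPoly.pderiv_gen, if_pos rfl, map_one, mul_one]
  · intro m _ hm
    rw [JetPoly.pderiv_gen, if_neg (by simpa using hm.symm), map_zero, mul_zero]
  · intro h; simp only [Finset.mem_range] at h; omega
  · intro β _ hβ
    refine Finset.sum_eq_zero fun m _ => ?_
    rw [JetPoly.pderiv_gen, if_neg (by simp [hβ.symm]), map_zero, mul_zero]
  · simp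

theorem lin_gen_eq_zero (u : ι → SForm) {v : JetVar ι} (hv : ∀ α n, v ≠ .lam α 0 n) :
    φ.lin u (JetPoly.gen v) = 0 := by
  obtain ⟨K, hK⟩ := exists_lin_eq (JetPoly.gen v)
  rw [hK K le_rfl]
  refine Finset.sum_eq_zero fun β _ => Finset.sum_eq_zero fun m _ => ?_
  rw [JetPoly.pderiv_gen, if_neg (hv β m), map_zero, mul_zero]

/-- Leibniz requires moving the direction past `φ.eval x`, which is free of signs because the
direction is even. -/
theorem lin_mul {u : ι → SForm} (hu : ∀ α z, (u α z).HasParity 0) (x y : JetPoly ι) :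
    φ.lin u (x * y) = φ.eval x * φ.lin u y + φ.lin u x * φ.eval y := by
  obtain ⟨K, hK⟩ := exists_lin_eq x
  obtain ⟨K', hK'⟩ := exists_lin_eq y
  obtain ⟨K'', hK''⟩ := exists_lin_eq (x * y)
  rw [hK (max K (max K' K'')) (by omega), hK' (max K (max K' K'')) (by omega),
    hK'' (max K (max K' K'')) (by omega)]
  simp only [Finset.mul_sum, Finset.sum_mul, ← Finset.sum_add_distrib]
  refine Finset.sum_congr rfl fun β _ => Finset.sum_congr rfl fun m _ => ?_
  have hc : SForm.dz^[m] (u β) * φ.eval x = φ.eval x * SForm.dz^[m] (u β) :=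
    funext fun z => (SForm.dz_parity (hu β) m z).even_comm _
  rw [JetPoly.pderiv_mul, map_add, map_mul, map_mul, mul_add, ← mul_assoc, hc, mul_assoc,
    mul_assoc]

end linearization

/-- Families of forms with jointly continuous coefficients. -/
def JointlyContinuous (R : ℝ → SForm) : Prop :=
  ∀ I, Continuous fun q : ℝ × ℂ => (R q.1 q.2).coeff I

/-- Families of forms whose coefficients are supported in a common compact set. -/
def UniformlySupported (R : ℝ → SForm) : Prop :=
  ∀ I, ∃ M : ℝ, ∀ (s : ℝ) (z : ℂ), M < |z.im| → (R s z).coeff I = 0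

theorem JointlyContinuous.of_smooth {F : SForm} (hF : F.IsSmooth) :
    JointlyContinuous fun _ => F := fun I => (hF.contDiff I).continuous.comp continuous_snd

theorem JointlyContinuous.add {R Q : ℝ → SForm} (hR : JointlyContinuous R)
    (hQ : JointlyContinuous Q) : JointlyContinuous (R + Q) := fun I => (hR I).add (hQ I)

theorem JointlyContinuous.mul {R Q : ℝ → SForm} (hR : JointlyContinuous R)
    (hQ : JointlyContinuous Q) : JointlyContinuous (R * Q) := fun I =>
  continuous_finsetSum _ fun J _ => continuous_const.mul ((hR J).mul (hQ (I \ J)))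

theorem JointlyContinuous.smul {R : ℝ → SForm} (hR : JointlyContinuous R) {c : ℝ → ℂ}
    (hc : Continuous c) : JointlyContinuous fun s => c s • R s := fun I =>
  (hc.comp continuous_fst).mul (hR I)

theorem UniformlySupported.of_compact {F : SForm} (hF : F.IsCompactlySupported) :
    UniformlySupported fun _ => F := fun I => (hF I).imp fun _ hM _ => hM

theorem UniformlySupported.add {R Q : ℝ → SForm} (hR : UniformlySupported R)
    (hQ : UniformlySupported Q) : UniformlySupported (R + Q) := fun I => by
  obtain ⟨M, hM⟩ := hR I
  obtain ⟨M', hM'⟩ := hQ I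
  refine ⟨max M M', fun s z hz => ?_⟩
  change (R s z + Q s z).coeff I = 0
  rw [Gr.add_apply, hM s z ((le_max_left _ _).trans_lt hz),
    hM' s z ((le_max_right _ _).trans_lt hz), add_zero]

theorem UniformlySupported.exists_bound {R : ℝ → SForm} (hR : UniformlySupported R)
    (I : Finset (WithTop ℕ)) :
    ∃ M : ℝ, ∀ J ⊆ I, ∀ (s : ℝ) (z : ℂ), M < |z.im| → (R s z).coeff J = 0 := by
  choose M hM using hR
  refine ⟨∑ J ∈ I.powerset, |M J|, fun J hJ s z hz => hM J s z ?_⟩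
  exact ((le_abs_self _).trans (Finset.single_le_sum (f := fun J => |M J|)
    (fun _ _ => abs_nonneg _) (Finset.mem_powerset.mpr hJ))).trans_lt hz

theorem UniformlySupported.mul_right {R : ℝ → SForm} (hR : UniformlySupported R)
    (Q : ℝ → SForm) : UniformlySupported (R * Q) := fun I => by
  obtain ⟨M, hM⟩ := hR.exists_bound I
  refine ⟨M, fun s z hz => Finset.sum_eq_zero fun J hJ => ?_⟩
  rw [hM J (Finset.mem_powerset.mp hJ) s z hz, zero_mul, mul_zero]

theorem UniformlySupported.mul_left {R : ℝ → SForm} (hR : UniformlySupported R)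
    (Q : ℝ → SForm) : UniformlySupported (Q * R) := fun I => by
  obtain ⟨M, hM⟩ := hR.exists_bound I
  refine ⟨M, fun s z hz => Finset.sum_eq_zero fun J _ => ?_⟩
  rw [hM (I \ J) Finset.sdiff_subset s z hz, mul_zero, mul_zero]

/-- Second order Taylor expansion of the value of a polynomial. -/
theorem exists_eval_shift_eq [Fintype ι] (φ : FieldPoint ι) {ψ : FieldPoint ι} {u : ι → SForm}
    (hψ : ψ.IsAlong u) (x : JetPoly ι) :
    ∃ R : ℝ → SForm, JointlyContinuous R ∧
      ((∀ α, (u α).IsCompactlySupported) → UniformlySupported R) ∧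
      ∀ s : ℝ, (φ.shift ψ s).eval x =
        φ.eval x + (s : ℂ) • φ.lin u x + (s : ℂ) ^ 2 • R s := by
  have hs : ∀ α, (u α).IsSmooth := fun α => hψ.1 α ▸ ψ.lam_smooth α 0
  have he : ∀ α z, (u α z).HasParity 0 := fun α => hψ.1 α ▸ ψ.lam_even α 0
  have h0 : JointlyContinuous 0 := fun I => continuous_const
  have h0' : UniformlySupported 0 := fun I => ⟨0, fun _ _ _ => rfl⟩
  induction x using JetPoly.induction with
  | algebraMap c =>
    refine ⟨0, h0, fun _ => h0', fun s => ?_⟩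
    rw [eval_algebraMap, eval_algebraMap, lin_algebraMap]
    simp
  | gen v =>
    -- Generators are linear in the field, so there is no second order remainder.
    refine ⟨0, h0, fun _ => h0', fun s => ?_⟩
    have key : ∀ {F K : SForm}, F.IsSmooth → K.IsSmooth → ∀ m, SForm.dz^[m]
        (fun z => F z + (s : ℂ) • K z) = SForm.dz^[m] F + (s : ℂ) • SForm.dz^[m] K := by
      intro F K hF hK m
      rw [← SForm.dz_iterate_smul hK, ← SForm.dz_iterate_add hF (hK.smul _)]
      rfl
    have hz : ∀ m, SForm.dz^[m] 0 = 0 := fun m => by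
      have := SForm.dz_iterate_smul (F := 0) (SForm.IsSmooth.const 0) 0 m
      rwa [smul_zero, zero_smul] at this
    rw [eval_gen, eval_gen, Pi.zero_apply, smul_zero, add_zero]
    cases v with
    | lam α k m =>
      refine (key (φ.lam_smooth α k) (ψ.lam_smooth α k) m).trans ?_
      cases k with
      | zero => rw [lin_lam_zero, hψ.1]; rfl
      | succ k =>
        rw [lin_gen_eq_zero φ u (by simp), hψ.2.1, hz]; rfl
    | rho α k m =>
      refine (key (φ.rho_smooth α k) (ψ.rho_smooth α k) m).trans ?_
      rw [lin_gen_eq_zero φ u (by simp), hψ.2.2, hz]; rfl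
  | mul x y hx hy =>
    obtain ⟨R, hR, hR', hRe⟩ := hx
    obtain ⟨Q, hQ, hQ', hQe⟩ := hy
    have c1 : Continuous fun s : ℝ => (s : ℂ) := Complex.continuous_ofReal
    have c2 : Continuous fun s : ℝ => (s : ℂ) ^ 2 := c1.pow 2
    -- The terms divisible by `s²` in the product of the two expansions. Each contains a factor
    -- `lin`, `R` or `Q`, which is why a compactly supported direction gives a uniformly supported
    -- remainder.
    refine ⟨(fun _ => φ.lin u x * φ.lin u y) + R * ((fun _ => φ.eval y) +
      (fun s : ℝ => (s : ℂ) • φ.lin u y) + fun s : ℝ => (s : ℂ) ^ 2 • Q s) +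
      ((fun _ => φ.eval x) + fun s : ℝ => (s : ℂ) • φ.lin u x) * Q, ?_, ?_, ?_⟩
    · have l := fun x => JointlyContinuous.of_smooth (φ.lin_smooth hs x)
      have e := fun x => JointlyContinuous.of_smooth (φ.eval_smooth x)
      exact (((l x).mul (l y)).add (hR.mul (((e y).add ((l y).smul c1)).add (hQ.smul c2)))).add
        (((e x).add ((l x).smul c1)).mul hQ)
    · intro hc
      exact ((UniformlySupported.of_compact ((φ.lin_compact hc x).mul_right _)).add
        ((hR' hc).mul_right _)).add ((hQ' hc).mul_left _)
    · intro s
      rw [map_mul, map_mul, hRe, hQe, lin_mul φ he]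
      simp only [Pi.add_apply, Pi.mul_apply, mul_add, add_mul, smul_mul_assoc, mul_smul_comm,
        smul_add, smul_smul]
      module
  | add x y hx hy =>
    obtain ⟨R, hR, hR', hRe⟩ := hx
    obtain ⟨Q, hQ, hQ', hQe⟩ := hy
    refine ⟨R + Q, hR.add hQ, fun hc => (hR' hc).add (hQ' hc), fun s => ?_⟩
    rw [map_add, map_add, map_add, hRe, hQe, Pi.add_apply]
    module

section linSeries

variable [Fintype ι] (φ : FieldPoint ι)

/-- The derivative of a power series at `φ` in the direction `u` of the `λ_0`'s. -/
noncomputable def linSeries (L : JetSeries ι) (u : ι → SForm) : SForm :=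
  fun z => ⟨fun I => (φ.lin u (L.trunc (I.card + 1)) z).coeff I⟩

/-- Differentiation lowers the degree by one, hence `I.card + 1` where evaluation needs only
`I.card`. -/
theorem linSeries_coeff (L : JetSeries ι) (u : ι → SForm) {I : Finset (WithTop ℕ)} {N : ℕ}
    (hN : I.card + 1 ≤ N) (z : ℂ) :
    (φ.linSeries L u z).coeff I = (φ.lin u (L.trunc N) z).coeff I := by
  refine JetSeries.apply_trunc_eq (SForm.coeffAt z I ∘ₗ φ.lin u) L (n := I.card + 1) ?_ le_rfl hN
  intro i hi
  obtain ⟨j, rfl⟩ : ∃ j, i = j + 1 := ⟨i - 1, by omega⟩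
  exact φ.lin_vanishesBelow u (L.homog _) z I (by omega)

theorem linSeries_smooth (L : JetSeries ι) {u : ι → SForm} (hu : ∀ α, (u α).IsSmooth) :
    (φ.linSeries L u).IsSmooth :=
  ⟨fun I => (φ.lin_smooth hu _).contDiff I, fun z => by
    ext I
    change (φ.lin u (L.trunc (I.card + 1)) (z + 1)).coeff I = _
    rw [(φ.lin_smooth hu _).periodic]
    rfl⟩

theorem linSeries_compact (L : JetSeries ι) {u : ι → SForm}
    (hu : ∀ α, (u α).IsCompactlySupported) : (φ.linSeries L u).IsCompactlySupported :=
  fun I => φ.lin_compact hu _ I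

theorem linSeries_add (L : JetSeries ι) {u v : ι → SForm} (hu : ∀ α, (u α).IsSmooth)
    (hv : ∀ α, (v α).IsSmooth) :
    φ.linSeries L (u + v) = φ.linSeries L u + φ.linSeries L v := by
  funext z
  ext I
  change (φ.lin (u + v) _ z).coeff I = _
  rw [lin_add φ hu hv]
  rfl

theorem linSeries_const_mul (L : JetSeries ι) (a : Gr (WithTop ℕ)) {u : ι → SForm}
    (hu : ∀ α, (u α).IsSmooth) :
    φ.linSeries L (fun α z => a * u α z) = (fun _ => a) * φ.linSeries L u := by
  funext z
  ext I
  rw [φ.linSeries_coeff L _ le_rfl, lin_const_mul φ a hu]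
  refine Gr.mul_coeff_congr (fun _ _ => rfl) fun J hJ => ?_
  rw [φ.linSeries_coeff L u (N := I.card + 1) (by have := Finset.card_le_card hJ; omega)]

/-- The remainder is allowed to depend on `I`, since it is that of the truncation which the
coefficient `I` sees. -/
theorem exists_evalSeries_shift_eq (L : JetSeries ι) {ψ : FieldPoint ι} {u : ι → SForm}
    (hψ : ψ.IsAlong u) (I : Finset (WithTop ℕ)) :
    ∃ R : ℝ → SForm, JointlyContinuous R ∧
      ((∀ α, (u α).IsCompactlySupported) → UniformlySupported R) ∧
      ∀ (s : ℝ) (z : ℂ), ((φ.shift ψ s).evalSeries L z).coeff I =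
        (φ.evalSeries L z).coeff I + s * (φ.linSeries L u z).coeff I +
          (s : ℂ) ^ 2 * (R s z).coeff I := by
  obtain ⟨R, hR, hR', h⟩ := φ.exists_eval_shift_eq hψ (L.trunc (I.card + 1))
  refine ⟨R, hR, hR', fun s z => ?_⟩
  rw [evalSeries_coeff _ L (Nat.le_succ _), evalSeries_coeff _ L (Nat.le_succ _),
    linSeries_coeff _ L u le_rfl, h]
  rfl

end linSeries

end FieldPoint

theorem SForm.IsSmooth.continuous {F : SForm} (hF : F.IsSmooth) (I : Finset (WithTop ℕ)) :
    Continuous fun z => (F z).coeff I := (hF.contDiff I).continuous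

/-! ### Derivatives of the functionals and the variational derivative. -/

section functionals

variable {ι : Type}

theorem currentIntegral_fnPart_coeff (F : SForm) (I : Finset ℕ) :
    (currentIntegral fun z => (F z).fnPart).coeff I =
      ∫ x in (0 : ℝ)..1, (F x).coeff (I.map Gr.emb) := rfl

theorem cylinderIntegral_barPart_coeff (F : SForm) (I : Finset ℕ) :
    (cylinderIntegral fun z => (F z).barPart).coeff I =
      -2 * Complex.I * cylInt fun z => (F z).coeff (insert ⊤ (I.map Gr.emb)) := rfl

theorem currentIntegral_fnPart_add {F K : SForm} (hF : F.IsSmooth) (hK : K.IsSmooth) :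
    (currentIntegral fun z => ((F + K) z).fnPart) =
      (currentIntegral fun z => (F z).fnPart) + currentIntegral fun z => (K z).fnPart := by
  ext I
  rw [Gr.add_apply]
  simp only [currentIntegral_fnPart_coeff]
  exact intervalIntegral.integral_add
    (((hF.continuous _).comp Complex.continuous_ofReal).intervalIntegrable _ _)
    (((hK.continuous _).comp Complex.continuous_ofReal).intervalIntegrable _ _)

/-- Support is asked only at nonempty indices: a series on a compactly supported field keeps its
constant term at infinity, which lives at the index `∅` and is invisible to the `d z̄` part. -/
theorem cylinderIntegral_barPart_add {F K : SForm} (hF : F.IsSmooth) (hK : K.IsSmooth)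
    (hF' : ∀ I, I ≠ ∅ → ∃ M : ℝ, ∀ z : ℂ, M < |z.im| → (F z).coeff I = 0)
    (hK' : ∀ I, I ≠ ∅ → ∃ M : ℝ, ∀ z : ℂ, M < |z.im| → (K z).coeff I = 0) :
    (cylinderIntegral fun z => ((F + K) z).barPart) =
      (cylinderIntegral fun z => (F z).barPart) + cylinderIntegral fun z => (K z).barPart := by
  ext I
  rw [Gr.add_apply]
  simp only [cylinderIntegral_barPart_coeff]
  rw [← mul_add, ← cylInt_add (hF.continuous _) (hK.continuous _)
    (hF' _ (by simp)) (hK' _ (by simp))]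
  rfl

theorem currentIntegral_const_mul {a : Gr (WithTop ℕ)} {F : SForm} (hF : F.IsSmooth) :
    (currentIntegral fun z => (((fun _ => a) * F : SForm) z).fnPart) =
      a.fnPart * currentIntegral fun z => (F z).fnPart := by
  ext I
  simp only [Pi.mul_apply, Gr.fnPart_mul]
  rw [Gr.mul_apply]
  simp only [currentIntegral, Gr.mul_apply]
  rw [intervalIntegral.integral_finsetSum]
  · simp only [intervalIntegral.integral_const_mul]
  · intro J _
    exact (((((hF.continuous _).comp Complex.continuous_ofReal).intervalIntegrable _ _).const_mul
      _).const_mul _)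

theorem cylinderIntegral_const_mul {a : Gr (WithTop ℕ)} (ha : a.barPart = 0) {F : SForm}
    (hF : F.IsSmooth) (hc : F.IsCompactlySupported) :
    (cylinderIntegral fun z => (((fun _ => a) * F : SForm) z).barPart) =
      a.fnPart * cylinderIntegral fun z => (F z).barPart := by
  ext I
  simp only [Pi.mul_apply, Gr.barPart_mul ha]
  rw [Gr.mul_apply]
  change -2 * Complex.I * cylInt (fun z => (a.fnPart * (F z).barPart).coeff I) = _
  simp only [Gr.mul_apply]
  rw [cylInt_sum, Finset.mul_sum]
  · refine Finset.sum_congr rfl fun J _ => ?_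
    rw [cylInt_const_mul, cylInt_const_mul, cylinderIntegral_barPart_coeff]
    simp only [Gr.barPart_apply]
    ring
  · exact fun J => continuous_const.mul (continuous_const.mul (hF.continuous _))
  · intro J
    obtain ⟨M, hM⟩ := hc (insert ⊤ ((I \ J).map Gr.emb))
    refine ⟨M, fun z hz => ?_⟩
    rw [Gr.barPart_apply, hM z hz, mul_zero, mul_zero]

theorem cylinderIntegral_dz {F : SForm} (hF : F.IsSmooth)
    (hF' : ∀ I, I ≠ ∅ → ∃ M : ℝ, ∀ z : ℂ, M < |z.im| → (F z).coeff I = 0) :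
    (cylinderIntegral fun z => (F.dz z).barPart) = 0 := by
  ext I
  rw [cylinderIntegral_barPart_coeff]
  simp only [SForm.dz_apply]
  rw [cylInt_wirtinger (hF.contDiff _) (fun z => by rw [hF.periodic]) (hF' _ (by simp)), mul_zero]
  rfl

variable [Fintype ι] (φ : FieldPoint ι)

theorem hasDerivAt_currentObservable (L : JetSeries ι) {ψ : FieldPoint ι} {u : ι → SForm}
    (hψ : ψ.IsAlong u) (I : Finset ℕ) :
    HasDerivAt (fun s : ℝ => (currentObservable L (φ.shift ψ s)).coeff I)
      ((currentIntegral fun z => (φ.linSeries L u z).fnPart).coeff I) 0 := by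
  obtain ⟨R, hR, -, h⟩ := φ.exists_evalSeries_shift_eq L hψ (I.map Gr.emb)
  have hs : ∀ α, (u α).IsSmooth := fun α => hψ.1 α ▸ ψ.lam_smooth α 0
  have c0 : Continuous fun x : ℝ => (φ.evalSeries L x).coeff (I.map Gr.emb) :=
    ((φ.evalSeries_smooth L).continuous _).comp Complex.continuous_ofReal
  have c1 : Continuous fun x : ℝ => (φ.linSeries L u x).coeff (I.map Gr.emb) :=
    ((φ.linSeries_smooth L hs).continuous _).comp Complex.continuous_ofReal
  have c2 : Continuous fun q : ℝ × ℝ => (R q.1 q.2).coeff (I.map Gr.emb) :=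
    (hR _).comp (continuous_fst.prodMk (Complex.continuous_ofReal.comp continuous_snd))
  have c3 : ∀ s, Continuous fun x : ℝ => (R s x).coeff (I.map Gr.emb) := fun s =>
    c2.comp (continuous_const.prodMk continuous_id)
  have hd := hasDerivAt_add_sq_mul (∫ x in (0 : ℝ)..1, (φ.evalSeries L x).coeff (I.map Gr.emb))
    (∫ x in (0 : ℝ)..1, (φ.linSeries L u x).coeff (I.map Gr.emb))
    (continuous_integral_re (f := fun s x => (R s x).coeff (I.map Gr.emb)) c2 0 1)
  refine hd.congr_of_eventuallyEq (Filter.Eventually.of_forall fun s => ?_)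
  beta_reduce
  rw [currentObservable, currentIntegral_fnPart_coeff]
  simp only [h]
  rw [intervalIntegral.integral_add, intervalIntegral.integral_add,
    intervalIntegral.integral_const_mul, intervalIntegral.integral_const_mul]
  · exact c0.intervalIntegrable _ _
  · exact (continuous_const.mul c1).intervalIntegrable _ _
  · exact (c0.add (continuous_const.mul c1)).intervalIntegrable _ _
  · exact (continuous_const.mul (c3 s)).intervalIntegrable _ _

/-- The linear term and the remainder inherit compact support from the direction, so `φ` itself may
be arbitrary. -/
theorem hasDerivAt_cylinderIntegral_sub (L : JetSeries ι) {ψ : FieldPoint ι} {u : ι → SForm}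
    (hψ : ψ.IsAlong u) (hc : ∀ α, (u α).IsCompactlySupported) (I : Finset ℕ) :
    HasDerivAt (fun s : ℝ => (cylinderIntegral fun z =>
        ((φ.shift ψ s).evalSeries L z - φ.evalSeries L z).barPart).coeff I)
      ((cylinderIntegral fun z => (φ.linSeries L u z).barPart).coeff I) 0 := by
  obtain ⟨R, hR, hR', h⟩ := φ.exists_evalSeries_shift_eq L hψ (insert ⊤ (I.map Gr.emb))
  have hs : ∀ α, (u α).IsSmooth := fun α => hψ.1 α ▸ ψ.lam_smooth α 0
  set I' := insert ⊤ (I.map Gr.emb) with hI'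
  have c1 : Continuous fun z => (φ.linSeries L u z).coeff I' :=
    (φ.linSeries_smooth L hs).continuous _
  have c3 : ∀ s, Continuous fun z : ℂ => (R s z).coeff I' := fun s =>
    (hR I').comp (continuous_const.prodMk continuous_id)
  obtain ⟨M, hM⟩ := φ.linSeries_compact L hc I'
  obtain ⟨M', hM'⟩ := hR' hc I'
  have hd := (hasDerivAt_add_sq_mul 0 (cylInt fun z => (φ.linSeries L u z).coeff I')
    (continuous_cylInt (f := fun s z => (R s z).coeff I') (hR I') hM')).const_mul
    (-2 * Complex.I)
  refine hd.congr_of_eventuallyEq (Filter.Eventually.of_forall fun s => ?_)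
  beta_reduce
  change -2 * Complex.I * cylInt (fun z =>
    ((φ.shift ψ s).evalSeries L z).coeff I' - (φ.evalSeries L z).coeff I') = _
  have e : ∀ z, ((φ.shift ψ s).evalSeries L z).coeff I' - (φ.evalSeries L z).coeff I' =
      s * (φ.linSeries L u z).coeff I' + (s : ℂ) ^ 2 * (R s z).coeff I' := fun z => by
    rw [h]; ring
  simp only [e]
  have c1' : Continuous fun z => (s : ℂ) * (φ.linSeries L u z).coeff I' := continuous_const.mul c1
  have c3' : Continuous fun z => (s : ℂ) ^ 2 * (R s z).coeff I' := continuous_const.mul (c3 s)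
  rw [cylInt_add c1' c3'
    ⟨M, fun z hz => by rw [hM z hz, mul_zero]⟩ ⟨M', fun z hz => by rw [hM' s z hz, mul_zero]⟩,
    cylInt_const_mul, cylInt_const_mul, zero_add]

-- Away from the support of the field only the constant term of the polynomial survives.
omit [Fintype ι] in
theorem FieldPoint.exists_eval_eq_const_add {φ : FieldPoint ι} (hφ : φ.IsCompactlySupported)
    (x : JetPoly ι) : ∃ (c : ℂ) (F : SForm), F.IsCompactlySupported ∧
      φ.eval x = algebraMap ℂ SForm c + F := by
  induction x using JetPoly.induction with
  | algebraMap c =>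
    exact ⟨c, 0, SForm.IsCompactlySupported.zero, by rw [add_zero]; exact AlgHom.commutes _ _⟩
  | gen v =>
    refine ⟨0, φ.evalVar v, ?_, by rw [map_zero, zero_add, eval_gen]⟩
    cases v with
    | lam α k m => exact (hφ α k).1.dz_iterate m
    | rho α k m => exact (hφ α k).2.dz_iterate m
  | mul x y hx hy =>
    obtain ⟨c, F, hF, h⟩ := hx
    obtain ⟨d, K, hK, h'⟩ := hy
    refine ⟨c * d, algebraMap ℂ SForm c * K + F * (algebraMap ℂ SForm d + K),
      (hK.mul_left _).add (hF.mul_right _), ?_⟩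
    rw [map_mul, h, h', map_mul, add_mul, mul_add, add_assoc]
  | add x y hx hy =>
    obtain ⟨c, F, hF, h⟩ := hx
    obtain ⟨d, K, hK, h'⟩ := hy
    refine ⟨c + d, F + K, hF.add hK, ?_⟩
    rw [map_add, h, h', map_add]
    abel

omit [Fintype ι] in
theorem FieldPoint.evalSeries_support {φ : FieldPoint ι} (hφ : φ.IsCompactlySupported)
    (L : JetSeries ι) (I : Finset (WithTop ℕ)) (hI : I ≠ ∅) :
    ∃ M : ℝ, ∀ z : ℂ, M < |z.im| → (φ.evalSeries L z).coeff I = 0 := by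
  obtain ⟨c, F, hF, h⟩ := FieldPoint.exists_eval_eq_const_add hφ (L.trunc I.card)
  obtain ⟨M, hM⟩ := hF I
  refine ⟨M, fun z hz => ?_⟩
  rw [φ.evalSeries_coeff L le_rfl, h, Pi.add_apply, Gr.add_apply, hM z hz, Pi.algebraMap_apply,
    Gr.algebraMap_apply, if_neg hI, add_zero]

-- The constant at infinity is killed by `∂_z`. Consequently the Hamiltonian field at a compactly
-- supported `φ` is compactly supported, even when the Euler derivatives are not.
omit [Fintype ι] in
theorem FieldPoint.dz_evalSeries_compact {φ : FieldPoint ι} (hφ : φ.IsCompactlySupported)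
    (L : JetSeries ι) : (φ.evalSeries L).dz.IsCompactlySupported := fun I => by
  obtain ⟨c, F, hF, h⟩ := FieldPoint.exists_eval_eq_const_add hφ (L.dz.trunc I.card)
  obtain ⟨c', F', hF', h'⟩ := FieldPoint.exists_eval_eq_const_add hφ (L.trunc I.card)
  obtain ⟨M, hM⟩ := hF'.dz I
  refine ⟨M, fun z hz => ?_⟩
  rw [← φ.evalSeries_dz, φ.evalSeries_coeff _ le_rfl, dz_trunc, eval_dz]
  have e : F' = φ.eval (L.trunc I.card) + fun _ => algebraMap ℂ (Gr (WithTop ℕ)) (-c') := by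
    rw [h']
    funext z
    simp
  rw [← hM z hz, e, SForm.dz_add (φ.eval_smooth _) (SForm.IsSmooth.const _), SForm.dz_const,
    add_zero]

/-- For compactly supported `φ` the functional is finite on its own, so it differs from the integral
of the difference of densities by a constant in `s`. -/
theorem hasDerivAt_localFunctional {φ : FieldPoint ι} (hφ : φ.IsCompactlySupported)
    (L : JetSeries ι) {ψ : FieldPoint ι} {u : ι → SForm} (hψ : ψ.IsAlong u)
    (hc : ∀ α, (u α).IsCompactlySupported) (I : Finset ℕ) :
    HasDerivAt (fun s : ℝ => (localFunctional L (φ.shift ψ s)).coeff I)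
      ((cylinderIntegral fun z => (φ.linSeries L u z).barPart).coeff I) 0 := by
  have hd := (hasDerivAt_cylinderIntegral_sub φ L hψ hc I).const_add ((localFunctional L φ).coeff I)
  refine hd.congr_of_eventuallyEq (Filter.Eventually.of_forall fun s => ?_)
  beta_reduce
  have hcs : (φ.shift ψ s).IsCompactlySupported := by
    intro α k
    have h1 : (ψ.lam α k).IsCompactlySupported := by
      cases k with
      | zero => rw [hψ.1]; exact hc α
      | succ k => rw [hψ.2.1]; exact SForm.IsCompactlySupported.zero
    have h2 : (ψ.rho α k).IsCompactlySupported := by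
      rw [hψ.2.2]; exact SForm.IsCompactlySupported.zero
    exact ⟨(hφ α k).1.add (h1.smul s), (hφ α k).2.add (h2.smul s)⟩
  set χ := φ.shift ψ s
  have h1 := cylinderIntegral_barPart_add (φ.evalSeries_smooth L)
    ((χ.evalSeries_smooth L).add ((φ.evalSeries_smooth L).smul (-1)))
    (FieldPoint.evalSeries_support hφ L) (fun I hI => by
      obtain ⟨M, hM⟩ := FieldPoint.evalSeries_support hφ L I hI
      obtain ⟨M', hM'⟩ := FieldPoint.evalSeries_support hcs L I hI
      refine ⟨max M M', fun z hz => ?_⟩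
      rw [Pi.add_apply, Gr.add_apply, Pi.smul_apply, Gr.smul_apply,
        hM z ((le_max_left _ _).trans_lt hz), hM' z ((le_max_right _ _).trans_lt hz)]
      simp)
  have e : φ.evalSeries L + (χ.evalSeries L + (-1 : ℂ) • φ.evalSeries L) = χ.evalSeries L := by
    module
  have e2 : χ.evalSeries L + (-1 : ℂ) • φ.evalSeries L = χ.evalSeries L - φ.evalSeries L := by
    module
  rw [e, e2] at h1
  rw [localFunctional, h1]
  rfl

omit [Fintype ι] in
theorem evalSeries_euler_coeff (L : JetSeries ι) (α : ι) {I : Finset (WithTop ℕ)} {N : ℕ}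
    (hN : I.card ≤ N) (z : ℂ) : (φ.evalSeries (L.euler α) z).coeff I =
      (φ.eval (JetPoly.euler α (L.trunc (N + 1))) z).coeff I := by
  obtain ⟨c, hc⟩ := L.coeff_zero_eq
  have : (L.euler α).trunc N = JetPoly.euler α (L.trunc (N + 1)) := by
    rw [JetSeries.trunc, JetSeries.trunc, Finset.sum_range_succ' L.coeff, map_add, hc]
    rw [JetPoly.euler, JetPoly.pderivSum_algebraMap, add_zero, map_sum]
    rfl
  rw [φ.evalSeries_coeff _ hN, this]

/-- Integration by parts against an arbitrary form `u` in place of the value of a polynomial. The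
boundary form is compactly supported because `u` is, whatever `φ` may be. -/
theorem FieldPoint.exists_lin_eq_euler {u : ι → SForm} (hu : ∀ α, (u α).IsSmooth)
    (hc : ∀ α, (u α).IsCompactlySupported) (x : JetPoly ι) :
    ∃ B : SForm, B.IsSmooth ∧ B.IsCompactlySupported ∧
      φ.lin u x = ∑ α, u α * φ.eval (JetPoly.euler α x) + B.dz := by
  obtain ⟨K, hK⟩ := exists_lin_eq x
  obtain ⟨K', hK'⟩ := JetPoly.exists_pderivSum_eq x
  have h : ∀ α m, ∃ B : SForm, B.IsSmooth ∧ B.IsCompactlySupported ∧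
      SForm.dz^[m] (u α) * φ.eval (JetPoly.pderiv α m x) = u α *
        φ.eval (((-JetPoly.dz) ^ m : Module.End ℂ (JetPoly ι)) (JetPoly.pderiv α m x)) + B.dz :=
    fun α m => SForm.exists_dz_iterate_mul_eq (hu α) (hc α) m (K := fun i =>
      φ.eval (((-JetPoly.dz) ^ i : Module.End ℂ (JetPoly ι)) (JetPoly.pderiv α m x)))
      (fun i => φ.eval_smooth _) fun i => by
        rw [pow_succ', Module.End.mul_apply, JetPoly.neg_dz_apply, map_smul, eval_dz]
  choose B hB hBc hBe using h
  refine ⟨∑ α, ∑ m ∈ Finset.range (max K K'), B α m,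
    SForm.IsSmooth.sum _ fun α => SForm.IsSmooth.sum _ fun m => hB α m,
    SForm.IsCompactlySupported.sum _ fun α => SForm.IsCompactlySupported.sum _ fun m => hBc α m, ?_⟩
  rw [hK (max K K') (le_max_left _ _), SForm.dz_sum _ fun α => SForm.IsSmooth.sum _ (hB α),
    ← Finset.sum_add_distrib]
  refine Finset.sum_congr rfl fun α _ => ?_
  rw [SForm.dz_sum _ (hB α), JetPoly.euler, hK' (max K K') (le_max_right _ _), map_sum,
    Finset.mul_sum, ← Finset.sum_add_distrib]
  exact Finset.sum_congr rfl fun m _ => hBe α m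

/-- The Euler operator gives a variational derivative. -/
theorem isVariationalDerivative_euler (L : JetSeries ι) :
    IsVariationalDerivative L φ fun α => φ.evalSeries (L.euler α) := by
  refine ⟨fun α => φ.evalSeries_smooth _, fun δφ v hv hc I => ?_⟩
  have hs : ∀ α, (v α).IsSmooth := fun α => hv.1 α ▸ δφ.lam_smooth α 0
  have hcv : ∀ α, (v α).IsCompactlySupported := fun α => hv.1 α ▸ (hc α 0).1
  have hd := hasDerivAt_cylinderIntegral_sub φ L hv hcv I
  convert hd using 1
  set I' := insert ⊤ (I.map Gr.emb) with hI'
  -- All terms are compared on the truncation seen by `I'`; the exact term `B.dz` then integrates to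
  -- zero.
  obtain ⟨B, hB, hBc, hBe⟩ := φ.exists_lin_eq_euler hs hcv (L.trunc (I'.card + 1))
  have e1 := cylinderIntegral_barPart_add
    (F := ∑ α, v α * φ.eval (JetPoly.euler α (L.trunc (I'.card + 1))))
    (SForm.IsSmooth.sum _ fun α => (hs α).mul (φ.eval_smooth _)) hB.dz
    (fun J _ => SForm.IsCompactlySupported.sum _ (fun α => (hcv α).mul_right _) J)
    (fun J _ => hBc.dz J)
  rw [cylinderIntegral_dz hB (fun J _ => hBc J), add_zero, ← hBe] at e1
  have e2 := congrArg (fun a => Gr.coeff a I) e1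
  simp only [cylinderIntegral_barPart_coeff] at e2 ⊢
  simp only [φ.linSeries_coeff L v (I := insert ⊤ (I.map Gr.emb)) le_rfl]
  rw [e2]
  change -2 * Complex.I * cylInt (fun z => (∑ α, v α z * φ.evalSeries (L.euler α) z).coeff I') = _
  congr 2
  funext z
  rw [Gr.sum_apply, SForm.sum_coeff]
  refine Finset.sum_congr rfl fun α _ => ?_
  refine Gr.mul_coeff_congr (fun J _ => rfl) fun J hJ => ?_
  exact evalSeries_euler_coeff φ L α (Finset.card_le_card hJ) z

/-! ### Uniqueness of variational derivatives and of derivatives along vector fields. -/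

/-- The field with prescribed components in the directions `λ_0`. -/
noncomputable def FieldPoint.along {ι : Type} (u : ι → SForm) (he : ∀ α z, (u α z).HasParity 0)
    (hs : ∀ α, (u α).IsSmooth) (hi : ∀ α, (u α).IsInfinitesimal) : FieldPoint ι where
  lam α k := if k = 0 then u α else 0
  rho _ _ := 0
  lam_even α k z := by split_ifs; exacts [he α z, fun _ _ => rfl]
  rho_odd _ _ _ _ _ := rfl
  lam_smooth α k := by split_ifs; exacts [hs α, SForm.IsSmooth.const 0]
  rho_smooth _ _ := SForm.IsSmooth.const 0
  lam_inf α k := by split_ifs; exacts [hi α, fun _ => ⟨rfl, rfl⟩]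
  rho_inf _ _ _ := ⟨rfl, rfl⟩

omit [Fintype ι] in
theorem FieldPoint.along_isAlong (u : ι → SForm) (he) (hs) (hi) :
    (FieldPoint.along u he hs hi).IsAlong u :=
  ⟨fun _ => rfl, fun _ _ => rfl, fun _ _ => rfl⟩

omit [Fintype ι] in
theorem FieldPoint.along_compact (u : ι → SForm) (he) (hs) (hi)
    (hc : ∀ α, (u α).IsCompactlySupported) :
    (FieldPoint.along u he hs hi).IsCompactlySupported := fun α k => by
  refine ⟨?_, SForm.IsCompactlySupported.zero⟩
  change (if k = 0 then u α else 0 : SForm).IsCompactlySupported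
  split_ifs
  exacts [hc α, SForm.IsCompactlySupported.zero]

/-- Supplies test monomials: two generators make an even infinitesimal direction, disjointness from
`J` keeps the coefficient, and `⊤ ∈ K ∪ J` makes the product visible to the `d z̄` part. -/
theorem exists_disjoint_card_two (J : Finset (WithTop ℕ)) :
    ∃ K : Finset (WithTop ℕ), Disjoint K J ∧ K.card = 2 ∧ ⊤ ∈ K ∪ J := by
  obtain ⟨n, hn⟩ := Infinite.exists_notMem_finset (J.preimage Gr.emb Gr.emb.injective.injOn)
  obtain ⟨m, hm⟩ := Infinite.exists_notMem_finset
    (insert n (J.preimage Gr.emb Gr.emb.injective.injOn))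
  simp only [Finset.mem_insert, Finset.mem_preimage, not_or] at hn hm
  by_cases h : ⊤ ∈ J
  · refine ⟨{Gr.emb n, Gr.emb m}, ?_, ?_, Finset.mem_union_right _ h⟩
    · rw [Finset.disjoint_insert_left, Finset.disjoint_singleton_left]
      exact ⟨hn, hm.2⟩
    · rw [Finset.card_pair]
      exact fun e => hm.1 (Gr.emb.injective e).symm
  · refine ⟨{Gr.emb n, ⊤}, ?_, ?_, ?_⟩
    · rw [Finset.disjoint_insert_left, Finset.disjoint_singleton_left]
      exact ⟨hn, h⟩
    · rw [Finset.card_pair]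
      exact WithTop.coe_ne_top
    · simp

/-- Vary only `λ^γ_0`, by `f` times the monomial `K`. The coefficient of the variation at `K ∪ J`
is, up to a nonzero constant, the integral of `f` against the coefficient `J` of `X γ`, and `f` is
an arbitrary test function. -/
theorem IsVariationalDerivative.unique {L : JetSeries ι} {φ : FieldPoint ι} {X X' : ι → SForm}
    (h : IsVariationalDerivative L φ X) (h' : IsVariationalDerivative L φ X') : X = X' := by
  classical
  funext γ z
  ext J
  obtain ⟨K, hKJ, hK2, htop⟩ := exists_disjoint_card_two J
  obtain ⟨I, hI⟩ := Gr.exists_eq_insert_map htop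
  rw [← sub_eq_zero]
  refine eq_zero_of_cylInt_mul (Y := fun z => (X γ z).coeff J - (X' γ z).coeff J)
    (((h.1 γ).contDiff J).sub ((h'.1 γ).contDiff J))
    (fun z => by rw [(h.1 γ).periodic, (h'.1 γ).periodic]) (fun f hf hp hc => ?_) z
  let u : ι → SForm := fun α => if α = γ then fun z => f z • Gr.monomial K else 0
  have hcoeff : ∀ z S, (f z • Gr.monomial K).coeff S = f z * if S = K then 1 else 0 :=
    fun _ _ => rfl
  have hsm : ∀ α, (u α).IsSmooth := by
    intro α
    simp only [u]
    split_ifs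
    · exact ⟨fun S => hf.mul contDiff_const, fun z => by rw [hp]⟩
    · exact SForm.IsSmooth.const 0
  have hcs : ∀ α, (u α).IsCompactlySupported := by
    intro α
    simp only [u]
    split_ifs
    · obtain ⟨M, hM⟩ := hc
      exact fun S => ⟨M, fun z hz => by rw [hcoeff, hM z hz, zero_mul]⟩
    · exact SForm.IsCompactlySupported.zero
  have hev : ∀ α z, (u α z).HasParity 0 := by
    intro α z S hS
    simp only [u]
    split_ifs
    · rw [hcoeff, if_neg, mul_zero]
      rintro rfl
      exact hS (by rw [hK2]; rfl)
    · rfl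
  have hin : ∀ α, (u α).IsInfinitesimal := by
    intro α z
    simp only [u]
    split_ifs
    · rw [hcoeff, hcoeff, if_neg, if_neg, mul_zero]
      · exact ⟨rfl, rfl⟩
      · rintro rfl; simp at hK2
      · rintro rfl; simp at hK2
    · exact ⟨rfl, rfl⟩
  have hal := FieldPoint.along_isAlong u hev hsm hin
  have hu := (h.2 _ u hal (FieldPoint.along_compact u hev hsm hin hcs) I).unique
    (h'.2 _ u hal (FieldPoint.along_compact u hev hsm hin hcs) I)
  have e : ∀ X : ι → SForm, ((cylinderIntegral fun z => (∑ α, u α z * X α z).barPart).coeff I) =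
      -2 * Complex.I * cylInt (fun z => f z * (Gr.sgn K J * (X γ z).coeff J)) := by
    intro X
    change -2 * Complex.I * cylInt (fun z => (∑ α, u α z * X α z).coeff (insert ⊤ (I.map _))) = _
    congr 2
    funext z
    rw [Finset.sum_eq_single γ (fun α _ hα => by simp [u, hα]) (by simp), ← hI]
    simp only [u, if_true]
    rw [smul_mul_assoc, Gr.smul_apply, Gr.monomial_mul_apply_union hKJ]
  rw [e, e, mul_right_inj' (by simp)] at hu
  have hcont : ∀ {X : SForm}, X.IsSmooth → Continuous fun z => f z * (Gr.sgn K J * (X z).coeff J) :=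
    fun hX => hf.continuous.mul (continuous_const.mul (hX.continuous J))
  obtain ⟨M, hM⟩ := hc
  have hneg : Continuous fun z => -1 * (f z * (Gr.sgn K J * (X' γ z).coeff J)) :=
    continuous_const.mul (hcont (h'.1 γ))
  have h2 := cylInt_add (hcont (h.1 γ)) hneg
    ⟨M, fun z hz => by rw [hM z hz, zero_mul]⟩ ⟨M, fun z hz => by rw [hM z hz, zero_mul, mul_zero]⟩
  rw [cylInt_const_mul, hu] at h2
  have h3 : (fun z => f z * (Gr.sgn K J * (X γ z).coeff J) +
      -1 * (f z * (Gr.sgn K J * (X' γ z).coeff J))) =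
      fun z => Gr.sgn K J * (f z * ((X γ z).coeff J - (X' γ z).coeff J)) := by
    funext z; ring
  rw [h3, cylInt_const_mul] at h2
  have h4 : Gr.sgn K J * cylInt (fun z => f z * ((X γ z).coeff J - (X' γ z).coeff J)) = 0 := by
    rw [h2]; ring
  exact (mul_eq_zero.mp h4).resolve_left (Gr.sgn_ne_zero K J)

-- For each parity `p`, multiplying by a parameter monomial of parity `p` disjoint from `J` turns
-- `V^p` into a legitimate even direction and exposes the coefficient `J` of `D' p`.
omit [Fintype ι] in
theorem HasDerivativeAlong.unique {O : FieldPoint ι → Gr ℕ} {φ : FieldPoint ι} {V : ι → SForm}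
    (hV : ∀ α, (V α).IsSmooth) {D E : Gr ℕ} (hD : HasDerivativeAlong O φ V D)
    (hE : HasDerivativeAlong O φ V E) : D = E := by
  obtain ⟨D', rfl, hD'⟩ := hD
  obtain ⟨E', rfl, hE'⟩ := hE
  have key : ∀ p, D' p = E' p := by
    intro p
    ext J
    -- Two fresh generators for even `p`, one for odd `p`. Being nonempty and free of `⊤`, `K` makes
    -- the direction infinitesimal.
    obtain ⟨K, hKJ, hKp, hK0⟩ : ∃ K : Finset ℕ, Disjoint K J ∧ (K.card : ZMod 2) = p ∧
        K ≠ ∅ := by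
      obtain ⟨n, hn⟩ := Infinite.exists_notMem_finset J
      obtain ⟨m, hm⟩ := Infinite.exists_notMem_finset (insert n J)
      simp only [Finset.mem_insert, not_or] at hm
      have : ∀ q : ZMod 2, q = 0 ∨ q = 1 := by decide
      rcases this p with rfl | rfl
      · refine ⟨{n, m}, by simp [hn, hm.2], ?_, by simp⟩
        rw [Finset.card_pair (Ne.symm hm.1)]
        rfl
      · exact ⟨{n}, by simp [hn], by simp, by simp⟩
    set a : Gr (WithTop ℕ) := Gr.monomial (K.map Gr.emb) with ha
    have hbar : a.barPart = 0 := by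
      ext S
      rw [Gr.barPart_apply, ha, Gr.monomial_apply, if_neg]
      · rfl
      · intro e
        exact Gr.top_notMem_map K (e ▸ Finset.mem_insert_self _ _)
    have hfn : a.fnPart = Gr.monomial K := by
      ext S
      rw [Gr.fnPart_apply, ha, Gr.monomial_apply, Gr.monomial_apply]
      simp only [Finset.map_inj]
    have hpar : a.HasParity p := by
      have := Gr.hasParity_monomial (K.map Gr.emb)
      rwa [Finset.card_map, hKp] at this
    let u : ι → SForm := fun α z => a * (V α z).part p
    have hev : ∀ α z, (u α z).HasParity 0 := by
      intro α z
      have := hpar.mul (Gr.hasParity_part p (V α z))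
      have h2 : ∀ q : ZMod 2, q + q = 0 := by decide
      rwa [h2] at this
    have hsm : ∀ α, (u α).IsSmooth := by
      intro α
      refine SForm.IsSmooth.mul (F := fun _ => a) (K := fun z => (V α z).part p)
        (SForm.IsSmooth.const a) ⟨fun S => ?_, fun z => by rw [(hV α).periodic]⟩
      simp only [Gr.part]
      split_ifs
      exacts [(hV α).contDiff S, contDiff_const]
    have hin : ∀ α, (u α).IsInfinitesimal := by
      intro α z
      have hmap : ∀ S : Finset (WithTop ℕ), ¬ K.map Gr.emb ⊆ S → (u α z).coeff S = 0 := by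
        intro S hS
        simp only [u, ha, Gr.monomial_mul_apply, if_neg hS]
      obtain ⟨k, hk⟩ := Finset.nonempty_iff_ne_empty.mpr hK0
      have hk' := Finset.mem_map_of_mem Gr.emb hk
      refine ⟨hmap _ fun h => ?_, hmap _ fun h => ?_⟩
      · simpa using h hk'
      · exact WithTop.coe_ne_top (Finset.mem_singleton.mp (h hk'))
    have hal := FieldPoint.along_isAlong u hev hsm hin
    have h := (hD' p a _ hbar hpar hal (K ∪ J)).unique (hE' p a _ hbar hpar hal (K ∪ J))
    rw [hfn, Gr.monomial_mul_apply_union hKJ, Gr.monomial_mul_apply_union hKJ] at h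
    exact mul_left_cancel₀ (Gr.sgn_ne_zero K J) h
  rw [key, key]

/-! ### Existence of derivatives along arbitrary vector fields. -/

theorem isSmooth_part {F : SForm} (hF : F.IsSmooth) (p : ZMod 2) :
    SForm.IsSmooth fun z => (F z).part p := by
  refine ⟨fun S => ?_, fun z => by rw [hF.periodic]⟩
  simp only [Gr.part]
  split_ifs
  exacts [hF.contDiff S, contDiff_const]

theorem isCompactlySupported_part {F : SForm} (hF : F.IsCompactlySupported) (p : ZMod 2) :
    SForm.IsCompactlySupported fun z => (F z).part p := by
  intro S
  obtain ⟨M, hM⟩ := hF S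
  refine ⟨M, fun z hz => ?_⟩
  simp only [Gr.part, hM z hz, ite_self]

omit [Fintype ι] in
theorem part_zero_add_part_one (V : ι → SForm) :
    ((fun α z => (V α z).part 0) + fun α z => (V α z).part 1) = V := by
  funext α z
  exact Gr.part_zero_add_part_one _

/-- The linearization is additive in the direction and left linear over constants, so the two parity
parts of `V` can be treated separately and reassembled. -/
theorem hasDerivativeAlong_currentObservable (L : JetSeries ι) {V : ι → SForm}
    (hV : ∀ α, (V α).IsSmooth) : HasDerivativeAlong (currentObservable L) φ V
      (currentIntegral fun z => (φ.linSeries L V z).fnPart) := by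
  have hs := fun p α => isSmooth_part (hV α) p
  refine ⟨fun p => currentIntegral fun z =>
    (φ.linSeries L (fun α z => (V α z).part p) z).fnPart, ?_, ?_⟩
  · rw [← currentIntegral_fnPart_add (φ.linSeries_smooth L (hs 0)) (φ.linSeries_smooth L (hs 1)),
      ← φ.linSeries_add L (hs 0) (hs 1), part_zero_add_part_one]
  · intro p a ψ _ _ hψ I
    have := hasDerivAt_currentObservable φ L hψ I
    rwa [φ.linSeries_const_mul L a (hs p),
      currentIntegral_const_mul (φ.linSeries_smooth L (hs p))] at this

theorem hasDerivativeAlong_localFunctional {φ : FieldPoint ι} (hφ : φ.IsCompactlySupported)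
    (L : JetSeries ι) {V : ι → SForm} (hV : ∀ α, (V α).IsSmooth)
    (hc : ∀ α, (V α).IsCompactlySupported) : HasDerivativeAlong (localFunctional L) φ V
      (cylinderIntegral fun z => (φ.linSeries L V z).barPart) := by
  have hs := fun p α => isSmooth_part (hV α) p
  have hcp := fun p α => isCompactlySupported_part (hc α) p
  refine ⟨fun p => cylinderIntegral fun z =>
    (φ.linSeries L (fun α z => (V α z).part p) z).barPart, ?_, ?_⟩
  · rw [← cylinderIntegral_barPart_add (φ.linSeries_smooth L (hs 0)) (φ.linSeries_smooth L (hs 1))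
      (fun J _ => φ.linSeries_compact L (hcp 0) J) (fun J _ => φ.linSeries_compact L (hcp 1) J),
      ← φ.linSeries_add L (hs 0) (hs 1), part_zero_add_part_one]
  · intro p a ψ ha _ hψ I
    have := hasDerivAt_localFunctional hφ L hψ (fun α => (hcp p α).mul_left fun _ => a) I
    rwa [φ.linSeries_const_mul L a (hs p), cylinderIntegral_const_mul ha
      (φ.linSeries_smooth L (hs p)) (φ.linSeries_compact L (hcp p))] at this

end functionals

/-! ### The BV bracket. -/

section bracket

variable {ι : Type} [Fintype ι] [DecidableEq ι] (g : Matrix ι ι ℂ)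

theorem hamiltonianField_eq (X : ι → SForm) :
    hamiltonianField g X = fun β => (-1 : ℂ) • ∑ α, g⁻¹ α β • (X α).dz := by
  funext β z
  simp [hamiltonianField]

theorem hamiltonianField_smooth {X : ι → SForm} (hX : ∀ α, (X α).IsSmooth) (β : ι) :
    (hamiltonianField g X β).IsSmooth := by
  rw [hamiltonianField_eq]
  exact (SForm.IsSmooth.sum _ fun α => (hX α).dz.smul _).smul _

/-- Uniqueness of the variational derivative fixes the vector field, and uniqueness of the
derivative along it fixes `D`; a single computed derivative therefore determines the bracket. -/
theorem isBVBracket_iff (L : JetSeries ι) (O : FieldPoint ι → Gr ℕ) (φ : FieldPoint ι)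
    {D₀ : Gr ℕ} (h : HasDerivativeAlong O φ
      (hamiltonianField g fun α => φ.evalSeries (L.euler α)) D₀) (D : Gr ℕ) :
    IsBVBracket g L O φ D ↔ D = D₀ := by
  constructor
  · rintro ⟨X, hX, hD⟩
    obtain rfl := hX.unique (isVariationalDerivative_euler φ L)
    exact hD.unique (hamiltonianField_smooth g hX.1) h
  · rintro rfl
    exact ⟨_, isVariationalDerivative_euler φ L, h⟩

omit [Fintype ι] [DecidableEq ι] in
theorem JetPoly.euler_algebraMap (α : ι) (c : ℂ) :
    JetPoly.euler α (algebraMap ℂ (JetPoly ι) c) = 0 := JetPoly.pderivSum_algebraMap _ _ _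

omit [Fintype ι] [DecidableEq ι] in
theorem JetPoly.boundary_algebraMap (α : ι) (x : JetPoly ι) (c : ℂ) :
    JetPoly.boundary α x (algebraMap ℂ (JetPoly ι) c) = 0 := JetPoly.pderivSum_algebraMap _ _ _

/-- The potential of the exact term in the bracket of a local functional and a current. -/
noncomputable def JetSeries.potential (L₁ L₂ : JetSeries ι) : JetSeries ι :=
  JetSeries.conv (JetPoly.potential g) (JetPoly.potential_mem g) L₁ L₂

/-- The derivative of `L₂` along the Hamiltonian vector field of `L₁`. -/
theorem linSeries_hamiltonianField (L₁ L₂ : JetSeries ι) (φ : FieldPoint ι) :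
    φ.linSeries L₂ (hamiltonianField g fun α => φ.evalSeries (L₁.euler α)) =
      φ.evalSeries (JetSeries.bracket g L₁ L₂) +
        φ.evalSeries (JetSeries.potential g L₁ L₂).dz := by
  funext z
  ext I
  set N := I.card with hN
  -- At the coefficient `I` every series may be replaced by its truncation, after which the claim is
  -- the polynomial identity.
  have hpot : ∀ z, (φ.eval ((JetSeries.potential g L₁ L₂).trunc N) z).coeff I =
      (φ.eval (JetPoly.potential g (L₁.trunc (N + 1)) (L₂.trunc (N + 1))) z).coeff I :=
    φ.eval_trunc_conv _ _
      (fun c x => by simp [JetPoly.potential_apply, JetPoly.euler_algebraMap])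
      (fun c x => by simp [JetPoly.potential_apply, JetPoly.euler_algebraMap,
        JetPoly.boundary_algebraMap]) L₁ L₂ le_rfl
  rw [Pi.add_apply, Gr.add_apply, φ.evalSeries_coeff _ le_rfl, φ.evalSeries_coeff _ le_rfl,
    JetSeries.bracket_eq_conv, φ.eval_trunc_conv (JetPoly.bracket g) _
      (fun c x => by simp [JetPoly.bracket_apply, JetPoly.euler_algebraMap])
      (fun c x => by simp [JetPoly.bracket_apply, JetPoly.euler_algebraMap]) L₁ L₂ le_rfl,
    FieldPoint.dz_trunc, FieldPoint.eval_dz,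
    show (SForm.dz (φ.eval ((JetSeries.potential g L₁ L₂).trunc N)) z).coeff I =
      (SForm.dz (φ.eval (JetPoly.potential g (L₁.trunc (N + 1)) (L₂.trunc (N + 1)))) z).coeff I from
      SForm.dz_iterate_coeff_congr hpot 1 z,
    ← FieldPoint.eval_dz, ← Gr.add_apply, ← Pi.add_apply, ← map_add,
    ← JetPoly.sum_pderivSum_hamiltonian, ← φ.lin_eval, φ.linSeries_coeff L₂ _ le_rfl]
  -- It remains that the Hamiltonian fields of `L₁` and of its truncation agree at every `J ⊆ I`,
  -- which is all that the coefficient `I` of the derivative sees.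
  refine φ.lin_coeff_congr (fun β J hJ z => ?_) _ z
  have e := congrFun (hamiltonianField_eq g fun α => φ.evalSeries (L₁.euler α)) β
  beta_reduce at e
  rw [e, JetPoly.hamiltonian, map_smul, map_sum, Pi.smul_apply, Pi.smul_apply,
    Gr.smul_apply, Gr.smul_apply, SForm.sum_coeff, SForm.sum_coeff]
  congr 1
  refine Finset.sum_congr rfl fun α _ => ?_
  rw [map_smul, Pi.smul_apply, Pi.smul_apply, Gr.smul_apply, Gr.smul_apply, FieldPoint.eval_dz]
  congr 1
  exact SForm.dz_iterate_coeff_congr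
    (fun z => evalSeries_euler_coeff φ L₁ α (Finset.card_le_card hJ) z) 1 z

theorem isBVBracket_currentObservable_iff (L₁ L₂ : JetSeries ι) (φ : FieldPoint ι) (D : Gr ℕ) :
    IsBVBracket g L₁ (currentObservable L₂) φ D ↔
      D = currentObservable (JetSeries.bracket g L₁ L₂) φ +
        currentObservable (JetSeries.potential g L₁ L₂).dz φ := by
  have h := hasDerivativeAlong_currentObservable φ L₂
    (hamiltonianField_smooth g fun α => φ.evalSeries_smooth (L₁.euler α))
  rw [linSeries_hamiltonianField, currentIntegral_fnPart_add (φ.evalSeries_smooth _)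
    (φ.evalSeries_smooth _)] at h
  exact isBVBracket_iff g L₁ _ φ h D

/-- The exact term left by the two integrations by parts is integrated over the whole cylinder and
vanishes by Stokes. -/
theorem isBVBracket_localFunctional_iff (L₁ L₂ : JetSeries ι) {φ : FieldPoint ι}
    (hφ : φ.IsCompactlySupported) (D : Gr ℕ) :
    IsBVBracket g L₁ (localFunctional L₂) φ D ↔
      D = localFunctional (JetSeries.bracket g L₁ L₂) φ := by
  have h := hasDerivativeAlong_localFunctional hφ L₂
    (hamiltonianField_smooth g fun α => φ.evalSeries_smooth (L₁.euler α)) fun β => by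
      rw [hamiltonianField_eq]
      exact (SForm.IsCompactlySupported.sum _ fun α =>
        (FieldPoint.dz_evalSeries_compact hφ _).smul _).smul _
  rw [linSeries_hamiltonianField, cylinderIntegral_barPart_add (φ.evalSeries_smooth _)
    (φ.evalSeries_smooth _) (FieldPoint.evalSeries_support hφ _)
    (FieldPoint.evalSeries_support hφ _), FieldPoint.evalSeries_dz,
    cylinderIntegral_dz (φ.evalSeries_smooth _) (FieldPoint.evalSeries_support hφ _),
    add_zero] at h
  exact isBVBracket_iff g L₁ _ φ h D

end bracket

/-! ### Fields holomorphic near the circle. -/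

section holomorphic

variable {ι : Type}

/-- The function part of the form is holomorphic on `U`. -/
def SForm.IsHolomorphicOn (U : Set ℂ) (F : SForm) : Prop :=
  ∀ I : Finset ℕ, ∀ z ∈ U, wirtingerBar (fun w => (F w).fnPart.coeff I) z = 0

theorem SForm.IsHolomorphicOn.dz_iterate {U : Set ℂ} (hU : IsOpen U) {F : SForm}
    (hs : F.IsSmooth) (hF : F.IsHolomorphicOn U) (m : ℕ) : (SForm.dz^[m] F).IsHolomorphicOn U := by
  induction m with
  | zero => exact hF
  | succ m ih =>
    rw [Function.iterate_succ_apply']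
    exact fun I z hz => wirtingerBar_wirtinger ((hs.dz_iterate m).contDiff _) hU (ih I) hz

/-- Taking function parts is multiplicative, so the function part of a polynomial involves only
function parts of the field and their `∂_z`-derivatives, all holomorphic on `U`. -/
theorem FieldPoint.eval_holomorphic {U : Set ℂ} (hU : IsOpen U) {φ : FieldPoint ι}
    (hl : ∀ α k, (φ.lam α k).IsHolomorphicOn U) (hr : ∀ α k, (φ.rho α k).IsHolomorphicOn U)
    (x : JetPoly ι) : (φ.eval x).IsHolomorphicOn U := by
  have hs : ∀ (x : JetPoly ι) (J : Finset ℕ),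
      ContDiff ℝ ∞ fun z => (φ.eval x z).fnPart.coeff J :=
    fun x J => (φ.eval_smooth x).contDiff (J.map Gr.emb)
  induction x using JetPoly.induction with
  | algebraMap c =>
    intro I z _
    rw [eval_algebraMap]
    simp [wirtingerBar]
  | gen v =>
    rw [eval_gen]
    cases v with
    | lam α k m => exact (hl α k).dz_iterate hU (φ.lam_smooth α k) m
    | rho α k m => exact (hr α k).dz_iterate hU (φ.rho_smooth α k) m
  | mul x y hx hy =>
    intro I z hz
    simp only [map_mul, Pi.mul_apply, Gr.fnPart_mul, Gr.mul_apply]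
    rw [wirtingerBar_sum _ fun J => contDiff_const.mul ((hs x J).mul (hs y (I \ J)))]
    refine Finset.sum_eq_zero fun J _ => ?_
    rw [wirtingerBar_const_mul ((hs x J).mul (hs y (I \ J))),
      wirtingerBar_mul (hs x J) (hs y (I \ J)),
      hx J z hz, hy (I \ J) z hz]
    ring
  | add x y hx hy =>
    intro I z hz
    rw [map_add]
    refine (wirtingerBar_add (hs x I) (hs y I) z).trans ?_
    rw [hx I z hz, hy I z hz, add_zero]

/-- The function part of `M` on such a field is holomorphic near `C`, so its `∂_z` restricts on `C`
to the derivative of a periodic function. -/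
theorem currentObservable_dz_eq_zero {φ : FieldPoint ι} (hφ : φ.IsHolomorphicNearCircle)
    (M : JetSeries ι) : currentObservable M.dz φ = 0 := by
  obtain ⟨ε, hε, h⟩ := hφ
  have hU : IsOpen {z : ℂ | |z.im| < ε} :=
    isOpen_lt (continuous_abs.comp Complex.continuous_im) continuous_const
  ext I
  rw [currentObservable, currentIntegral_fnPart_coeff, FieldPoint.evalSeries_dz]
  have e : (fun z => (φ.evalSeries M z).coeff (I.map Gr.emb)) =
      fun z => (φ.eval (M.trunc (I.map Gr.emb).card) z).coeff (I.map Gr.emb) :=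
    funext fun z => φ.evalSeries_coeff M le_rfl z
  simp only [SForm.dz_apply, e]
  have hs := φ.eval_smooth (M.trunc (I.map Gr.emb).card)
  refine integral_wirtinger_eq_zero (hs.contDiff _) (fun z => by rw [hs.periodic]) fun x => ?_
  exact FieldPoint.eval_holomorphic hU (fun α k J z hz => (h α k J z hz).1)
    (fun α k J z hz => (h α k J z hz).2) _ I x (by simpa using hε)

end holomorphic

theorem mainTheorem7 {ι : Type} [Fintype ι] [DecidableEq ι] (g : Matrix ι ι ℂ)
    (hsymm : g.IsSymm) (hdet : IsUnit g.det) (L₁ L₂ : JetSeries ι) :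
    ((∃ M : JetSeries ι, ∀ (φ : FieldPoint ι) (D : Gr ℕ),
        IsBVBracket g L₁ (currentObservable L₂) φ D ↔
          D = currentObservable (JetSeries.bracket g L₁ L₂) φ + currentObservable M.dz φ) ∧
      (∀ φ : FieldPoint ι, φ.IsHolomorphicNearCircle → ∀ D : Gr ℕ,
        IsBVBracket g L₁ (currentObservable L₂) φ D ↔
          D = currentObservable (JetSeries.bracket g L₁ L₂) φ)) ∧
    ∀ φ : FieldPoint ι, φ.IsCompactlySupported → ∀ D : Gr ℕ,
      IsBVBracket g L₁ (localFunctional L₂) φ D ↔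
        D = localFunctional (JetSeries.bracket g L₁ L₂) φ := by
  refine ⟨⟨⟨JetSeries.potential g L₁ L₂, isBVBracket_currentObservable_iff g L₁ L₂⟩,
    fun φ hφ D => ?_⟩, fun φ hφ D => isBVBracket_localFunctional_iff g L₁ L₂ hφ D⟩
  rw [isBVBracket_currentObservable_iff, currentObservable_dz_eq_zero hφ, add_zero]
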